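/- Let $(M^m,g)$ and $(N^n,h)$ be smooth Riemannian manifolds and let $\phi:(M^m,g)\to(N^n,h)$ be a Riemannian submersion, i.e. a smooth map such that for every $x\in M$ the differential $d\phi_x:T_xM\to T_{\phi(x)}N$ is onto and its restriction to the horizontal space $\mathcal H_x=(\ker d\phi_x)^{\perp}$ is an isometry; let $\mathcal V_x=\ker d\phi_x$ be the vertical space, and let $X^{\mathcal H}$, $X^{\mathcal V}$ denote the horizontal and vertical parts of a vector field $X$ on $M$. Let $\nabla^M,\nabla^N$ be the Levi-Civita connections and $\nabla^\phi$ the pull-back connection on $\phi^{-1}TN$. Put $R^N(X,Y)Z=\nabla^N_X\nabla^N_YZ-\nabla^N_Y\nabla^N_XZ-\nabla^N_{[X,Y]}Z$ and let $\mathrm{Ricci}^N(X)=\sum_k R^N(X,b_k)b_k$, for $\{b_k\}$ an orthonormal basis, be the Ricci operator of $(N,h)$. Let $\tau(\phi)=\mathrm{Trace}_g\nabla d\phi$ be the tension field and $$\tau_2(\phi)=-\Delta^\phi\tau(\phi)-\mathrm{Trace}_g R^N(d\phi,\tau(\phi))d\phi,\qquad \Delta^\phi=-\mathrm{Trace}_g\big(\nabla^\phi\nabla^\phi-\nabla^\phi_{\nabla^M}\big),$$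 the bitension field of $\phi$. Let $\{e_i\}_{1\le i\le n}\cup\{e_s\}_{n+1\le s\le m}$ be a smooth orthonormal frame on an open set $U\subseteq M$ with all $e_i$ horizontal and all $e_s$ vertical, and let $$\mu=\frac1{m-n}\sum_{s=n+1}^m(\nabla^M_{e_s}e_s)^{\mathcal H}$$ be the mean curvature vector field of the fibers (with $\mu=0$ if $m=n$). Then on $U$ $$\begin{aligned}\tau_2(\phi)=&-(m-n)\,d\phi\Big(\sum_{i=1}^n\big\{\nabla^M_{e_i}(\nabla^M_{e_i}\mu)^{\mathcal H}-\nabla^M_{(\nabla^M_{e_i}e_i)^{\mathcal H}}\mu+[\mu,(\nabla^M_{e_i}e_i)^{\mathcal V}]\big\}\\&\quad+\sum_{s=n+1}^m\big\{[[\mu,e_s],e_s]+[\mu,(\nabla^M_{e_s}e_s)^{\mathcal V}]\big\}-(m-n)\nabla^M_\mu\mu\Big)-(m-n)\,\mathrm{Ricci}^N(d\phi(\mu)).\end{aligned}$$ -/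

import Mathlib

open Bundle Manifold
open scoped ContDiff Manifold Topology

namespace RiemSubm

noncomputable section

variable
  {E : Type*} [NormedAddCommGroup E] [NormedSpace ℝ E] [FiniteDimensional ℝ E]
  {H : Type*} [TopologicalSpace H] (I : ModelWithCorners ℝ E H)
  {M : Type*} [TopologicalSpace M] [ChartedSpace H M] [IsManifold I ∞ M]
  {E' : Type*} [NormedAddCommGroup E'] [NormedSpace ℝ E'] [FiniteDimensional ℝ E']
  {H' : Type*} [TopologicalSpace H'] (J : ModelWithCorners ℝ E' H')
  {N : Type*} [TopologicalSpace N] [ChartedSpace H' N] [IsManifold J ∞ N]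

instance instFiniteDimensionalTangentSpace (x : M) : FiniteDimensional ℝ (TangentSpace I x) :=
  inferInstanceAs (FiniteDimensional ℝ E)

/-! ## The Levi-Civita connection, curvature and Ricci operator -/

section LeviCivita

variable [RiemannianBundle (fun x : M => TangentSpace I x)]

/-- The extension of a tangent vector at `x` to a vector field which is smooth near `x`
(it has constant coefficients in the chart at `x`). -/
def extVec {x : M} (v : TangentSpace I x) : Π y : M, TangentSpace I y :=
  FiberBundle.extend E v

/-- The directional derivative `v f` of a real function. -/
def dirDeriv (f : M → ℝ) {x : M} (v : TangentSpace I x) : ℝ :=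
  mvfderiv I f x v

/-- The Koszul expression: for a Riemannian metric `⟨·,·⟩` and vector fields `X, Y, Z`, the number
`½ (X⟨Y,Z⟩ + Y⟨X,Z⟩ - Z⟨X,Y⟩ + ⟨[X,Y],Z⟩ - ⟨[X,Z],Y⟩ - ⟨[Y,Z],X⟩)` at the point `x`. -/
def koszul (X Y Z : Π y : M, TangentSpace I y) (x : M) : ℝ :=
  (1 / 2 : ℝ) *
    (dirDeriv I (fun y => inner ℝ (Y y) (Z y)) (X x)
      + dirDeriv I (fun y => inner ℝ (X y) (Z y)) (Y x)
      - dirDeriv I (fun y => inner ℝ (X y) (Y y)) (Z x)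
      + inner ℝ (VectorField.mlieBracket I X Y x) (Z x)
      - inner ℝ (VectorField.mlieBracket I X Z x) (Y x)
      - inner ℝ (VectorField.mlieBracket I Y Z x) (X x))

/-- The Levi-Civita connection `∇_v Y` (for `v` a tangent vector at `x` and `Y` a vector field
which is differentiable at `x`): the tangent vector at `x` with
`⟨∇_v Y, z⟩ = koszul (v, Y, z)` for all `z`, written out in an orthonormal basis of the tangent
space. The right-hand side depends on `v` and `z` only, not on the way they are extended. -/
def nabla {x : M} (v : TangentSpace I x) (Y : Π y : M, TangentSpace I y) : TangentSpace I x :=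
  ∑ k, koszul I (extVec I v) Y (extVec I (stdOrthonormalBasis ℝ (TangentSpace I x) k)) x •
    stdOrthonormalBasis ℝ (TangentSpace I x) k

/-- The vector field `∇_X Y`. -/
def nablaField (X Y : Π y : M, TangentSpace I y) : Π y : M, TangentSpace I y :=
  fun y => nabla I (X y) Y

/-- The curvature `R(u,v)w = ∇_X ∇_Y Z - ∇_Y ∇_X Z - ∇_[X,Y] Z` at `x`, where `X, Y, Z` extend the
tangent vectors `u, v, w` at `x`. -/
def curvature {x : M} (u v w : TangentSpace I x) : TangentSpace I x :=
  nabla I u (nablaField I (extVec I v) (extVec I w)) - nabla I v (nablaField I (extVec I u) (extVec I w))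
    - nabla I (VectorField.mlieBracket I (extVec I u) (extVec I v) x) (extVec I w)

/-- The Ricci operator `Ricci(u) = ∑ₖ R(u, bₖ)bₖ`, with `b` an orthonormal basis of the tangent
space (the trace does not depend on it). -/
def ricci {x : M} (u : TangentSpace I x) : TangentSpace I x :=
  ∑ k, curvature I u (stdOrthonormalBasis ℝ (TangentSpace I x) k)
    (stdOrthonormalBasis ℝ (TangentSpace I x) k)

end LeviCivita

/-! ## Calculus along a map: pull-back connection, tension field, bitension field -/

section AlongMap

variable [RiemannianBundle (fun y : N => TangentSpace J y)] (φ : M → N)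

/-- The section `dφ(X)` of `φ⁻¹TN` for a vector field `X` on `M`. -/
def push (X : Π y : M, TangentSpace I y) : Π y : M, TangentSpace J (φ y) :=
  fun y => mfderiv I J φ y (X y)

/-- The pull-back connection `∇^φ_v σ` on `φ⁻¹TN`. If `E_k` is the frame of `TN` near `φ x` given
by the chart at `φ x` and `σ = ∑ σᵏ E_k ∘ φ` near `x`, then
`∇^φ_v σ = ∑ v(σᵏ) E_k(φ x) + ∑ σᵏ(x) ∇^N_{dφ(v)} E_k`;
the function `y ↦ (σᵏ(y))` is the fiber coordinate of `σ` in the trivialization at `φ x`, and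
`extVec (σ x)` is the vector field `∑ σᵏ(x) E_k`. -/
def pullNabla {x : M} (v : TangentSpace I x) (σ : Π y : M, TangentSpace J (φ y)) :
    TangentSpace J (φ x) :=
  (trivializationAt E' (TangentSpace J : N → Type _) (φ x)).symm (φ x)
      (mvfderiv I (fun y =>
        (trivializationAt E' (TangentSpace J : N → Type _) (φ x) ⟨φ y, σ y⟩).2) x v)
    + nabla J (mfderiv I J φ x v) (extVec J (σ x))

variable [RiemannianBundle (fun x : M => TangentSpace I x)]

/-- The second fundamental form `∇dφ(v,w) = ∇^φ_v dφ(W) - dφ(∇_v W)`, where `W` extends `w`. -/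
def secondFundForm {x : M} (v w : TangentSpace I x) : TangentSpace J (φ x) :=
  pullNabla I J φ v (push I J φ (extVec I w)) - mfderiv I J φ x (nabla I v (extVec I w))

/-- The tension field `τ(φ) = Trace_g ∇dφ`. -/
def tension : Π x : M, TangentSpace J (φ x) := fun x =>
  ∑ k, secondFundForm I J φ (stdOrthonormalBasis ℝ (TangentSpace I x) k)
    (stdOrthonormalBasis ℝ (TangentSpace I x) k)

/-- The second covariant derivative `(∇^φ)²_{v,w} σ = ∇^φ_v ∇^φ_W σ - ∇^φ_{∇_v W} σ` of a section
of `φ⁻¹TN`, where `W` extends `w`. -/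
def secondCovDeriv {x : M} (v w : TangentSpace I x) (σ : Π y : M, TangentSpace J (φ y)) :
    TangentSpace J (φ x) :=
  pullNabla I J φ v (fun y => pullNabla I J φ (extVec I w y) σ)
    - pullNabla I J φ (nabla I v (extVec I w)) σ

/-- The Laplacian `Δ^φ = -Trace_g (∇^φ)²` on sections of `φ⁻¹TN`. -/
def pullLaplacian (σ : Π y : M, TangentSpace J (φ y)) : Π x : M, TangentSpace J (φ x) := fun x =>
  - ∑ k, secondCovDeriv I J φ (stdOrthonormalBasis ℝ (TangentSpace I x) k)
    (stdOrthonormalBasis ℝ (TangentSpace I x) k) σ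

/-- The bitension field `τ₂(φ) = -Δ^φ τ(φ) - Trace_g R^N(dφ, τ(φ))dφ`. -/
def bitension : Π x : M, TangentSpace J (φ x) := fun x =>
  - pullLaplacian I J φ (tension I J φ) x
    - ∑ k, curvature J (mfderiv I J φ x (stdOrthonormalBasis ℝ (TangentSpace I x) k))
        (tension I J φ x)
        (mfderiv I J φ x (stdOrthonormalBasis ℝ (TangentSpace I x) k))

/-! ## Riemannian submersions -/

/-- The vertical space `V_x = ker dφ_x`. -/
def vertical (x : M) : Submodule ℝ (TangentSpace I x) := LinearMap.ker (mfderiv I J φ x).toLinearMap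

/-- The horizontal space `H_x`, the orthogonal complement of the vertical space. -/
def horizontal (x : M) : Submodule ℝ (TangentSpace I x) := (vertical I J φ x)ᗮ

/-- The vertical part `X^V` of a vector field. -/
def verPart (X : Π y : M, TangentSpace I y) : Π y : M, TangentSpace I y :=
  fun y => (vertical I J φ y).starProjection (X y)

/-- The horizontal part `X^H` of a vector field. -/
def horPart (X : Π y : M, TangentSpace I y) : Π y : M, TangentSpace I y :=
  fun y => (horizontal I J φ y).starProjection (X y)

/-- `φ` is a Riemannian submersion: a smooth map whose differential at every point is onto and
preserves the inner products of horizontal vectors. -/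
structure IsRiemannianSubmersion : Prop where
  smooth : ContMDiff I J ∞ φ
  surjective : ∀ x : M, Function.Surjective (mfderiv I J φ x)
  isometric : ∀ (x : M) (v w : TangentSpace I x), v ∈ horizontal I J φ x →
    w ∈ horizontal I J φ x → inner ℝ (mfderiv I J φ x v) (mfderiv I J φ x w) = inner ℝ v w

/-- `(e_i), (f_s)` is an orthonormal frame on the open set `U` adapted to `φ`: smooth vector fields
on `U`, with `e_i` horizontal and `f_s` vertical, which form an orthonormal basis of the tangent
space at each point of `U`. -/
structure IsAdaptedFrame {ι κ : Type*} (U : Set M) (e : ι → Π y : M, TangentSpace I y)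
    (f : κ → Π y : M, TangentSpace I y) : Prop where
  isOpen : IsOpen U
  smooth_e : ∀ i, ContMDiffOn I I.tangent ∞ (fun y => (⟨y, e i y⟩ : TangentBundle I M)) U
  smooth_f : ∀ s, ContMDiffOn I I.tangent ∞ (fun y => (⟨y, f s y⟩ : TangentBundle I M)) U
  horizontal_e : ∀ i, ∀ y ∈ U, e i y ∈ horizontal I J φ y
  vertical_f : ∀ s, ∀ y ∈ U, f s y ∈ vertical I J φ y
  orthonormal : ∀ y ∈ U, Orthonormal ℝ (Sum.elim (fun i => e i y) (fun s => f s y))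
  span : ∀ y ∈ U, Submodule.span ℝ (Set.range (Sum.elim (fun i => e i y) (fun s => f s y))) = ⊤

/-- The vector field `(1/r) ∑ₛ (∇_{f_s} f_s)^H` for a family of `r` vertical vector fields: the
mean curvature vector field of the fibers if `(f_s)` is an orthonormal frame of the fibers. (It is
zero if the fibers are points, `r = 0`.) -/
def meanCurvature {r : ℕ} (f : Fin r → Π y : M, TangentSpace I y) : Π y : M, TangentSpace I y :=
  fun y => (1 / (r : ℝ)) • ∑ s, horPart I J φ (nablaField I (f s) (f s)) y

end AlongMap

end

end RiemSubm

set_option linter.unusedSectionVars false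

namespace RiemSubm

section Nabla

open VectorField

variable
  {E : Type*} [NormedAddCommGroup E] [NormedSpace ℝ E] [FiniteDimensional ℝ E]
  {H : Type*} [TopologicalSpace H] {I : ModelWithCorners ℝ E H}
  {M : Type*} [TopologicalSpace M] [ChartedSpace H M] [IsManifold I ∞ M]

/-! ### Constant extensions of tangent vectors -/

@[simp]
lemma extVec_self {x : M} (v : TangentSpace I x) : extVec I v x = v :=
  FiberBundle.extend_apply_self E v

lemma mdifferentiableAt_extVec {x : M} (v : TangentSpace I x) : MDiffAt (T% (extVec I v)) x :=
  FiberBundle.mdifferentiableAt_extend (I := I) (F := E) v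

lemma extVec_eq {x : M} (v : TangentSpace I x) {y : M}
    (hy : y ∈ (trivializationAt E (TangentSpace I : M → Type _) x).baseSet) :
    extVec I v y = (trivializationAt E (TangentSpace I : M → Type _) x).symmL ℝ y
      ((trivializationAt E (TangentSpace I : M → Type _) x).continuousLinearMapAt ℝ x v) := by
  have hx : x ∈ (trivializationAt E (TangentSpace I : M → Type _) x).baseSet :=
    FiberBundle.mem_baseSet_trivializationAt' x
  rw [Trivialization.symmL_apply _ hy, Trivialization.continuousLinearMapAt_apply,
    Trivialization.coe_linearMapAt_of_mem _ hx]
  rfl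

lemma eventually_mem_baseSet (x : M) :
    ∀ᶠ y in 𝓝 x, y ∈ (trivializationAt E (TangentSpace I : M → Type _) x).baseSet :=
  (trivializationAt E (TangentSpace I : M → Type _) x).open_baseSet.mem_nhds
    (FiberBundle.mem_baseSet_trivializationAt' x)

lemma extVec_add {x : M} (v w : TangentSpace I x) :
    ∀ᶠ y in 𝓝 x, extVec I (v + w) y = (extVec I v + extVec I w) y := by
  filter_upwards [eventually_mem_baseSet (I := I) x] with y hy
  simp only [Pi.add_apply, extVec_eq _ hy, map_add]

lemma extVec_smul {x : M} (c : ℝ) (v : TangentSpace I x) :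
    ∀ᶠ y in 𝓝 x, extVec I (c • v) y = (c • extVec I v) y := by
  filter_upwards [eventually_mem_baseSet (I := I) x] with y hy
  simp only [Pi.smul_apply, extVec_eq _ hy, map_smul]

lemma contMDiffOn_extVec {x : M} (v : TangentSpace I x) :
    CMDiff[(trivializationAt E (TangentSpace I : M → Type _) x).baseSet] ∞ (T% (extVec I v)) := by
  rw [Trivialization.contMDiffOn_section_baseSet_iff]
  apply (contMDiffOn_const (c := (trivializationAt E (TangentSpace I : M → Type _) x
    ⟨x, v⟩).2)).congr
  intro y hy
  change (trivializationAt E (TangentSpace I : M → Type _) x ⟨y, FiberBundle.extend E v y⟩).2 = _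
  simp only [FiberBundle.extend]
  rw [Trivialization.apply_mk_symm _ hy]

variable [RiemannianBundle (fun x : M => TangentSpace I x)]
  [IsContMDiffRiemannianBundle I ∞ E (fun x : M => TangentSpace I x)]

/-! ### The Koszul expression -/

variable {X X' Y Y' Z Z' : Π y : M, TangentSpace I y} {x : M}

lemma mdifferentiableAt_inner (hX : MDiffAt (T% X) x) (hY : MDiffAt (T% Y) x) :
    MDiffAt (fun y => inner ℝ (X y) (Y y)) x :=
  MDifferentiableAt.inner_bundle (F := E) (E := fun x : M => TangentSpace I x) hX hY

lemma dirDeriv_inner_add_left (v : TangentSpace I x) (hX : MDiffAt (T% X) x)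
    (hX' : MDiffAt (T% X') x) (hY : MDiffAt (T% Y) x) :
    dirDeriv I (fun y => inner ℝ ((X + X') y) (Y y)) v
      = dirDeriv I (fun y => inner ℝ (X y) (Y y)) v
        + dirDeriv I (fun y => inner ℝ (X' y) (Y y)) v := by
  simp only [Pi.add_apply, inner_add_left, dirDeriv]
  rw [mvfderiv_fun_add (mdifferentiableAt_inner hX hY) (mdifferentiableAt_inner hX' hY)]
  rfl

lemma dirDeriv_inner_smul_left (v : TangentSpace I x) {f : M → ℝ} (hf : MDiffAt f x)
    (hX : MDiffAt (T% X) x) (hY : MDiffAt (T% Y) x) :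
    dirDeriv I (fun y => inner ℝ ((f • X) y) (Y y)) v
      = f x * dirDeriv I (fun y => inner ℝ (X y) (Y y)) v
        + dirDeriv I f v * inner ℝ (X x) (Y x) := by
  simp only [Pi.smul_apply', real_inner_smul_left, dirDeriv]
  rw [mvfderiv_fun_mul hf (mdifferentiableAt_inner hX hY)]
  simp [mul_comm]

lemma dirDeriv_inner_comm (v : TangentSpace I x) :
    dirDeriv I (fun y => inner ℝ (X y) (Y y)) v = dirDeriv I (fun y => inner ℝ (Y y) (X y)) v := by
  simp only [real_inner_comm]

lemma dirDeriv_add (f : M → ℝ) (v w : TangentSpace I x) :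
    dirDeriv I f (v + w) = dirDeriv I f v + dirDeriv I f w := map_add _ _ _

lemma dirDeriv_smul (f : M → ℝ) (c : ℝ) (v : TangentSpace I x) :
    dirDeriv I f (c • v) = c * dirDeriv I f v := map_smul _ _ _

lemma koszul_add_left (hX : MDiffAt (T% X) x) (hX' : MDiffAt (T% X') x) (hY : MDiffAt (T% Y) x)
    (hZ : MDiffAt (T% Z) x) :
    koszul I (X + X') Y Z x = koszul I X Y Z x + koszul I X' Y Z x := by
  simp only [koszul, Pi.add_apply, dirDeriv_add]
  have h1 := dirDeriv_inner_add_left (Y x) hX hX' hZ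
  have h2 := dirDeriv_inner_add_left (Z x) hX hX' hY
  simp only [Pi.add_apply] at h1 h2
  rw [h1, h2, mlieBracket_add_left hX hX', mlieBracket_add_left hX hX']
  simp only [inner_add_left, inner_add_right]
  ring

lemma koszul_smul_left {f : M → ℝ} (hf : MDiffAt f x) (hX : MDiffAt (T% X) x)
    (hY : MDiffAt (T% Y) x) (hZ : MDiffAt (T% Z) x) :
    koszul I (f • X) Y Z x = f x * koszul I X Y Z x := by
  simp only [koszul]
  rw [dirDeriv_inner_smul_left (Y x) hf hX hZ, dirDeriv_inner_smul_left (Z x) hf hX hY,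
    mlieBracket_smul_left hf hX, mlieBracket_smul_left hf hX]
  simp only [Pi.smul_apply', dirDeriv_smul, inner_add_left, real_inner_smul_left,
    real_inner_smul_right]
  simp only [dirDeriv]
  ring

lemma koszul_add_right (hX : MDiffAt (T% X) x) (hY : MDiffAt (T% Y) x)
    (hZ : MDiffAt (T% Z) x) (hZ' : MDiffAt (T% Z') x) :
    koszul I X Y (Z + Z') x = koszul I X Y Z x + koszul I X Y Z' x := by
  simp only [koszul]
  rw [dirDeriv_inner_comm (X := Y), dirDeriv_inner_comm (X := X),
    dirDeriv_inner_add_left _ hZ hZ' hY, dirDeriv_inner_add_left _ hZ hZ' hX,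
    mlieBracket_add_right hZ hZ', mlieBracket_add_right hZ hZ', dirDeriv_inner_comm (X := Z),
    dirDeriv_inner_comm (X := Z), dirDeriv_inner_comm (X := Z'), dirDeriv_inner_comm (X := Z')]
  simp only [Pi.add_apply, dirDeriv_add, inner_add_left, inner_add_right]
  ring

lemma koszul_smul_right {f : M → ℝ} (hf : MDiffAt f x) (hX : MDiffAt (T% X) x)
    (hY : MDiffAt (T% Y) x) (hZ : MDiffAt (T% Z) x) :
    koszul I X Y (f • Z) x = f x * koszul I X Y Z x := by
  simp only [koszul]
  rw [dirDeriv_inner_comm (X := Y), dirDeriv_inner_comm (X := X),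
    dirDeriv_inner_smul_left _ hf hZ hY, dirDeriv_inner_smul_left _ hf hZ hX,
    mlieBracket_smul_right hf hZ, mlieBracket_smul_right hf hZ, dirDeriv_inner_comm (X := Z),
    dirDeriv_inner_comm (X := Z)]
  simp only [Pi.smul_apply', dirDeriv_smul, inner_add_left, real_inner_smul_left,
    real_inner_smul_right]
  simp only [dirDeriv]
  rw [real_inner_comm (X x) (Z x), real_inner_comm (Y x) (Z x)]
  ring

lemma koszul_add_middle (hX : MDiffAt (T% X) x) (hY : MDiffAt (T% Y) x)
    (hY' : MDiffAt (T% Y') x) (hZ : MDiffAt (T% Z) x) :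
    koszul I X (Y + Y') Z x = koszul I X Y Z x + koszul I X Y' Z x := by
  simp only [koszul]
  rw [dirDeriv_inner_comm (X := X) (Y := Y + Y'), dirDeriv_inner_add_left _ hY hY' hX,
    dirDeriv_inner_add_left _ hY hY' hZ, mlieBracket_add_right hY hY',
    mlieBracket_add_left hY hY', dirDeriv_inner_comm (X := X) (Y := Y),
    dirDeriv_inner_comm (X := X) (Y := Y')]
  simp only [Pi.add_apply, dirDeriv_add, inner_add_left, inner_add_right]
  ring

lemma koszul_smul_middle {f : M → ℝ} (hf : MDiffAt f x) (hX : MDiffAt (T% X) x)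
    (hY : MDiffAt (T% Y) x) (hZ : MDiffAt (T% Z) x) :
    koszul I X (f • Y) Z x
      = f x * koszul I X Y Z x + dirDeriv I f (X x) * inner ℝ (Y x) (Z x) := by
  simp only [koszul]
  rw [dirDeriv_inner_comm (X := X) (Y := f • Y), dirDeriv_inner_smul_left _ hf hY hX,
    dirDeriv_inner_smul_left _ hf hY hZ, mlieBracket_smul_right hf hY,
    mlieBracket_smul_left hf hY, dirDeriv_inner_comm (X := X) (Y := Y)]
  simp only [Pi.smul_apply', dirDeriv_smul, inner_add_left, real_inner_smul_left,
    real_inner_smul_right]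
  simp only [dirDeriv]
  ring

lemma koszul_add_koszul_swap :
    koszul I X Y Z x + koszul I X Z Y x = dirDeriv I (fun y => inner ℝ (Y y) (Z y)) (X x) := by
  simp only [koszul]
  rw [dirDeriv_inner_comm (X := Z) (Y := Y), mlieBracket_swap_apply (V := Z) (W := Y),
    inner_neg_left]
  ring

lemma koszul_sub_koszul_swap :
    koszul I X Y Z x - koszul I Y X Z x = inner ℝ (mlieBracket I X Y x) (Z x) := by
  simp only [koszul]
  rw [dirDeriv_inner_comm (X := Y) (Y := X), mlieBracket_swap_apply (V := Y) (W := X),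
    inner_neg_left]
  ring

lemma tensorialAt_koszul_left (hY : MDiffAt (T% Y) x) (hZ : MDiffAt (T% Z) x) :
    TensorialAt I E (fun X => koszul I X Y Z x) x where
  smul hf hX := koszul_smul_left hf hX hY hZ
  add hX hX' := koszul_add_left hX hX' hY hZ

lemma tensorialAt_koszul_right (hX : MDiffAt (T% X) x) (hY : MDiffAt (T% Y) x) :
    TensorialAt I E (fun Z => koszul I X Y Z x) x where
  smul hf hZ := koszul_smul_right hf hX hY hZ
  add hZ hZ' := koszul_add_right hX hY hZ hZ'

/-! ### The Levi-Civita connection -/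

lemma inner_nabla (hX : MDiffAt (T% X) x) (hY : MDiffAt (T% Y) x) (hZ : MDiffAt (T% Z) x) :
    inner ℝ (nabla I (X x) Y) (Z x) = koszul I X Y Z x := by
  let K : TangentSpace I x →L[ℝ] TangentSpace I x →L[ℝ] ℝ :=
    TensorialAt.mkHom₂ (fun X Z => koszul I X Y Z x) x (fun Z hZ => tensorialAt_koszul_left hY hZ)
      (fun X hX => tensorialAt_koszul_right hX hY)
  have hK {X Z : Π y : M, TangentSpace I y} (hX : MDiffAt (T% X) x) (hZ : MDiffAt (T% Z) x) :
      K (X x) (Z x) = koszul I X Y Z x := TensorialAt.mkHom₂_apply _ _ hX hZ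
  have hK' (v w : TangentSpace I x) : koszul I (extVec I v) Y (extVec I w) x = K v w := by
    rw [← hK (mdifferentiableAt_extVec v) (mdifferentiableAt_extVec w), extVec_self, extVec_self]
  rw [← hK hX hZ]
  simp only [nabla, hK', sum_inner, real_inner_smul_left]
  conv_rhs => rw [← (stdOrthonormalBasis ℝ (TangentSpace I x)).sum_repr' (Z x)]
  simp only [map_sum, map_smul, smul_eq_mul, mul_comm]

lemma inner_nabla_extVec (v w : TangentSpace I x) (hY : MDiffAt (T% Y) x) :
    inner ℝ (nabla I v Y) w = koszul I (extVec I v) Y (extVec I w) x := by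
  rw [← inner_nabla (mdifferentiableAt_extVec v) hY (mdifferentiableAt_extVec w), extVec_self,
    extVec_self]

lemma nabla_add_left (v w : TangentSpace I x) (hY : MDiffAt (T% Y) x) :
    nabla I (v + w) Y = nabla I v Y + nabla I w Y := by
  refine ext_inner_right ℝ fun z => ?_
  have h := inner_nabla (mdifferentiableAt_add_section (mdifferentiableAt_extVec v)
    (mdifferentiableAt_extVec w)) hY (mdifferentiableAt_extVec z)
  simp only [Pi.add_apply, extVec_self] at h
  rw [h, inner_add_left, inner_nabla_extVec _ _ hY, inner_nabla_extVec _ _ hY, koszul_add_left]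
  all_goals first | exact mdifferentiableAt_extVec _ | exact hY

lemma nabla_smul_left (c : ℝ) (v : TangentSpace I x) (hY : MDiffAt (T% Y) x) :
    nabla I (c • v) Y = c • nabla I v Y := by
  refine ext_inner_right ℝ fun z => ?_
  have hc : MDiffAt (fun _ : M => c) x := mdifferentiableAt_const
  have h := inner_nabla (hc.smul_section (mdifferentiableAt_extVec v)) hY
    (mdifferentiableAt_extVec z)
  simp only [Pi.smul_apply', extVec_self] at h
  rw [h, real_inner_smul_left, inner_nabla_extVec _ _ hY]
  exact koszul_smul_left hc (mdifferentiableAt_extVec v) hY (mdifferentiableAt_extVec z)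

lemma nabla_add_right (v : TangentSpace I x) (hY : MDiffAt (T% Y) x) (hY' : MDiffAt (T% Y') x) :
    nabla I v (Y + Y') = nabla I v Y + nabla I v Y' := by
  refine ext_inner_right ℝ fun z => ?_
  rw [inner_add_left, inner_nabla_extVec _ _ hY, inner_nabla_extVec _ _ hY',
    inner_nabla_extVec _ _ (mdifferentiableAt_add_section hY hY'), koszul_add_middle]
  all_goals first | exact mdifferentiableAt_extVec _ | assumption

lemma nabla_smul_right (v : TangentSpace I x) {f : M → ℝ} (hf : MDiffAt f x)
    (hY : MDiffAt (T% Y) x) :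
    nabla I v (f • Y) = f x • nabla I v Y + dirDeriv I f v • Y x := by
  refine ext_inner_right ℝ fun z => ?_
  rw [inner_add_left, real_inner_smul_left, real_inner_smul_left, inner_nabla_extVec _ _ hY,
    inner_nabla_extVec _ _ (hf.smul_section hY), koszul_smul_middle hf
    (mdifferentiableAt_extVec v) hY (mdifferentiableAt_extVec z), extVec_self, extVec_self]

lemma dirDeriv_inner (v : TangentSpace I x) (hY : MDiffAt (T% Y) x) (hZ : MDiffAt (T% Z) x) :
    dirDeriv I (fun y => inner ℝ (Y y) (Z y)) v
      = inner ℝ (nabla I v Y) (Z x) + inner ℝ (Y x) (nabla I v Z) := by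
  have h := koszul_add_koszul_swap (X := extVec I v) (Y := Y) (Z := Z) (x := x)
  rw [extVec_self] at h
  rw [← h, ← inner_nabla (mdifferentiableAt_extVec v) hY hZ,
    ← inner_nabla (mdifferentiableAt_extVec v) hZ hY, extVec_self, real_inner_comm (Y x)]

lemma nabla_sub_nabla_swap (hX : MDiffAt (T% X) x) (hY : MDiffAt (T% Y) x) :
    nabla I (X x) Y - nabla I (Y x) X = mlieBracket I X Y x := by
  refine ext_inner_right ℝ fun z => ?_
  have hz := mdifferentiableAt_extVec z
  have h := koszul_sub_koszul_swap (X := X) (Y := Y) (Z := extVec I z) (x := x)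
  rw [← inner_nabla hX hY hz, ← inner_nabla hY hX hz, extVec_self] at h
  rw [inner_sub_left, h]

end Nabla


section Germs

open VectorField

variable
  {E : Type*} [NormedAddCommGroup E] [NormedSpace ℝ E] [FiniteDimensional ℝ E]
  {H : Type*} [TopologicalSpace H] {I : ModelWithCorners ℝ E H}
  {M : Type*} [TopologicalSpace M] [ChartedSpace H M] [IsManifold I ∞ M]
  {V : Type*} [NormedAddCommGroup V] [NormedSpace ℝ V]

lemma mvfderiv_congr {f g : M → V} {x : M} (h : f =ᶠ[𝓝 x] g) :
    mvfderiv I f x = mvfderiv I g x := by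
  ext v
  change (mfderiv I 𝓘(ℝ, V) f x v : V) = (mfderiv I 𝓘(ℝ, V) g x v : V)
  rw [h.mfderiv_eq]
  rfl

lemma contMDiffOn_dirDeriv {U : Set M} (hU : IsOpen U) {f : M → ℝ}
    {X : Π y : M, TangentSpace I y} (hf : CMDiff[U] ∞ f) (hX : CMDiff[U] ∞ (T% X)) :
    CMDiff[U] ∞ (fun y => dirDeriv I f (X y)) := by
  have h1 := hf.contMDiffOn_tangentMapWithin (m := ∞) (by simp) hU.uniqueMDiffOn
  have h2 := h1.comp hX (fun y hy => hy)
  have h3 := (contMDiff_snd_tangentBundle_modelSpace ℝ 𝓘(ℝ, ℝ) (n := ∞)).comp_contMDiffOn h2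
  refine h3.congr fun y hy => ?_
  change (mfderiv I 𝓘(ℝ, ℝ) f y (X y) : ℝ) = (mfderivWithin I 𝓘(ℝ, ℝ) f U y (X y) : ℝ)
  rw [mfderivWithin_of_isOpen hU hy]

lemma extVec_eq_mfderivWithin {x : M} (v : TangentSpace I x) {y : M}
    (hy : y ∈ (extChartAt I x).source) :
    extVec I v y = mfderivWithin 𝓘(ℝ, E) I (extChartAt I x).symm (Set.range I) (extChartAt I x y)
      ((trivializationAt E (TangentSpace I : M → Type _) x).continuousLinearMapAt ℝ x v) := by
  have hy' : y ∈ (chartAt H x).source := by simpa using hy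
  rw [extVec_eq v (by simpa using hy'), TangentBundle.symmL_trivializationAt hy']
  rfl

lemma mpullbackWithin_extVec {x : M} (v : TangentSpace I x) :
    ∀ᶠ z in 𝓝[Set.range I] (extChartAt I x x),
      mpullbackWithin 𝓘(ℝ, E) I (extChartAt I x).symm (extVec I v) (Set.range I) z
        = (trivializationAt E (TangentSpace I : M → Type _) x).continuousLinearMapAt ℝ x v := by
  filter_upwards [extChartAt_target_mem_nhdsWithin (I := I) x] with z hz
  rw [mpullbackWithin_apply, extVec_eq_mfderivWithin v ((extChartAt I x).map_target hz),
    (extChartAt I x).right_inv hz]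
  have h := isInvertible_mfderivWithin_extChartAt_symm (I := I) hz
  exact h.inverse_apply_eq.2 rfl

lemma mlieBracket_extVec_extVec {x : M} (v w : TangentSpace I x) :
    mlieBracket I (extVec I v) (extVec I w) x = 0 := by
  rw [← mlieBracketWithin_univ, mlieBracketWithin_apply, Set.preimage_univ, Set.univ_inter,
    Filter.EventuallyEq.lieBracketWithin_vectorField_eq_of_mem (mpullbackWithin_extVec v)
      (mpullbackWithin_extVec w) (by simp)]
  simp only [lieBracketWithin, fderivWithin_const_apply, zero_apply, sub_self]
  exact map_zero _

variable [RiemannianBundle (fun x : M => TangentSpace I x)]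
  {X X' Y Y' Z Z' : Π y : M, TangentSpace I y} {x : M}

lemma koszul_congr_middle (h : ∀ᶠ y in 𝓝 x, Y y = Y' y) :
    koszul I X Y Z x = koszul I X Y' Z x := by
  have h1 : (fun y => inner ℝ (Y y) (Z y)) =ᶠ[𝓝 x] fun y => inner ℝ (Y' y) (Z y) :=
    h.mono fun y hy => by simp [hy]
  have h2 : (fun y => inner ℝ (X y) (Y y)) =ᶠ[𝓝 x] fun y => inner ℝ (X y) (Y' y) :=
    h.mono fun y hy => by simp [hy]
  have h3 : Y =ᶠ[𝓝 x] Y' := h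
  simp only [koszul, dirDeriv, mvfderiv_congr h1, mvfderiv_congr h2, h.self_of_nhds,
    Filter.EventuallyEq.rfl.mlieBracket_vectorField_eq h3,
    h3.mlieBracket_vectorField_eq (Filter.EventuallyEq.refl (𝓝 x) Z)]

lemma nabla_congr (v : TangentSpace I x) (h : ∀ᶠ y in 𝓝 x, Y y = Y' y) :
    nabla I v Y = nabla I v Y' := by
  simp only [nabla, koszul_congr_middle h]

/-! ### Smoothness of the Levi-Civita connection -/

lemma contMDiffOn_mlieBracket {U : Set M} (hU : IsOpen U) (hX : CMDiff[U] ∞ (T% X))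
    (hY : CMDiff[U] ∞ (T% Y)) : CMDiff[U] ∞ (T% (mlieBracket I X Y)) := by
  have : IsManifold I (minSmoothness ℝ 2) M := by
    rw [minSmoothness_of_isRCLikeNormedField]
    infer_instance
  have : IsManifold I (∞ + 1) M := inferInstanceAs (IsManifold I ∞ M)
  have h := ContMDiffOn.mlieBracketWithin_vectorField (m := ⊤) (n := ⊤) (I := I) hX hY
    hU.uniqueMDiffOn (by simp)
  exact h.congr fun y hy => by rw [mlieBracketWithin_of_isOpen hU hy]

lemma contMDiffAt_det {ι : Type*} [Fintype ι] [DecidableEq ι] {G : M → Matrix ι ι ℝ}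
    (hG : ∀ i j, CMDiffAt ∞ (fun y => G y i j) x) : CMDiffAt ∞ (fun y => (G y).det) x := by
  simp only [Matrix.det_apply']
  exact contMDiffAt_finsetSum fun σ _ =>
    contMDiffAt_const.mul (contMDiffAt_finsetProd fun i _ => hG _ _)

lemma contMDiffAt_of_vecMul_eq {ι : Type*} [Fintype ι] [DecidableEq ι] {G : M → Matrix ι ι ℝ}
    {c κ : M → ι → ℝ} (hG : ∀ i j, CMDiffAt ∞ (fun y => G y i j) x)
    (hκ : ∀ i, CMDiffAt ∞ (fun y => κ y i) x) (hdet : ∀ᶠ y in 𝓝 x, (G y).det ≠ 0)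
    (h : ∀ᶠ y in 𝓝 x, Matrix.vecMul (c y) (G y) = κ y) (i : ι) :
    CMDiffAt ∞ (fun y => c y i) x := by
  have key : CMDiffAt ∞ (fun y => ((G y).det)⁻¹ * ∑ j, κ y j * (G y).adjugate j i) x := by
    refine ((contMDiffAt_det hG).inv₀ hdet.self_of_nhds).mul
      (contMDiffAt_finsetSum fun j _ => (hκ j).mul ?_)
    simp only [Matrix.adjugate_apply]
    refine contMDiffAt_det fun k l => ?_
    by_cases hk : k = i
    · subst hk
      simp only [Matrix.updateRow_self]
      exact contMDiffAt_const
    · simp only [Matrix.updateRow_ne hk]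
      exact hG k l
  refine key.congr_of_eventuallyEq ?_
  filter_upwards [hdet, h] with y hy hy'
  have h1 : Matrix.vecMul (κ y) (G y).adjugate = (G y).det • c y := by
    rw [← hy', Matrix.vecMul_vecMul, Matrix.mul_adjugate, Matrix.vecMul_smul, Matrix.vecMul_one]
  have h2 : ∑ j, κ y j * (G y).adjugate j i = (G y).det * c y i := congrFun h1 i
  rw [h2, inv_mul_cancel_left₀ hy]

variable [IsContMDiffRiemannianBundle I ∞ E (fun x : M => TangentSpace I x)]

lemma contMDiffOn_inner {U : Set M} (hX : CMDiff[U] ∞ (T% X)) (hY : CMDiff[U] ∞ (T% Y)) :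
    CMDiff[U] ∞ (fun y => inner ℝ (X y) (Y y)) :=
  ContMDiffOn.inner_bundle (F := E) (E := fun x : M => TangentSpace I x) hX hY

lemma contMDiffOn_koszul {U : Set M} (hU : IsOpen U) (hX : CMDiff[U] ∞ (T% X))
    (hY : CMDiff[U] ∞ (T% Y)) (hZ : CMDiff[U] ∞ (T% Z)) :
    CMDiff[U] ∞ (fun y => koszul I X Y Z y) := by
  unfold koszul
  refine contMDiffOn_const.mul (((((?_ : ContMDiffOn _ _ _ _ _).add ?_).sub ?_).add ?_).sub ?_
    |>.sub ?_)
  · exact contMDiffOn_dirDeriv hU (contMDiffOn_inner hY hZ) hX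
  · exact contMDiffOn_dirDeriv hU (contMDiffOn_inner hX hZ) hY
  · exact contMDiffOn_dirDeriv hU (contMDiffOn_inner hX hY) hZ
  · exact contMDiffOn_inner (contMDiffOn_mlieBracket hU hX hY) hZ
  · exact contMDiffOn_inner (contMDiffOn_mlieBracket hU hX hZ) hY
  · exact contMDiffOn_inner (contMDiffOn_mlieBracket hU hY hZ) hX

lemma mdifferentiableAt_of_contMDiffOn {U : Set M} (hU : IsOpen U) (hX : CMDiff[U] ∞ (T% X))
    (hx : x ∈ U) : MDiffAt (T% X) x :=
  (hX.contMDiffAt (hU.mem_nhds hx)).mdifferentiableAt (by simp)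

lemma det_gram_ne_zero {ι : Type*} [Fintype ι] [DecidableEq ι] {F : Type*} [NormedAddCommGroup F]
    [InnerProductSpace ℝ F] {v : ι → F} (hv : LinearIndependent ℝ v) :
    (Matrix.of fun i j => inner ℝ (v i) (v j)).det ≠ 0 := by
  intro h
  obtain ⟨c, hc, hc'⟩ := Matrix.exists_vecMul_eq_zero_iff.2 h
  refine hc (funext fun i => Fintype.linearIndependent_iff.1 hv c ?_ i)
  rw [← inner_self_eq_zero (𝕜 := ℝ)]
  conv_lhs => rw [inner_sum]
  refine Finset.sum_eq_zero fun j _ => ?_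
  rw [inner_smul_right, sum_inner]
  have := congrFun hc' j
  simp only [Matrix.vecMul, dotProduct, Matrix.of_apply, Pi.zero_apply] at this
  simp only [inner_smul_left, RCLike.conj_to_real, this, mul_zero]

lemma contMDiffOn_nablaField {U : Set M} (hU : IsOpen U) (hX : CMDiff[U] ∞ (T% X))
    (hY : CMDiff[U] ∞ (T% Y)) : CMDiff[U] ∞ (T% (nablaField I X Y)) := by
  intro x hx
  apply ContMDiffAt.contMDiffWithinAt
  let t := trivializationAt E (TangentSpace I : M → Type _) x
  let b := Module.finBasis ℝ E
  have hx' : x ∈ t.baseSet := FiberBundle.mem_baseSet_trivializationAt' x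
  have hB := (t.isLocalFrameOn_localFrame_baseSet I ∞ b).mono
    (Set.inter_subset_right (s := U))
  have hV : IsOpen (U ∩ t.baseSet) := hU.inter t.open_baseSet
  have hnhds : U ∩ t.baseSet ∈ 𝓝 x := hV.mem_nhds ⟨hx, hx'⟩
  refine hB.contMDiffAt_of_coeff (fun a => ?_) hnhds
  refine contMDiffAt_of_vecMul_eq
    (G := fun y => Matrix.of fun i j => inner ℝ (t.localFrame b i y) (t.localFrame b j y))
    (κ := fun y i => koszul I X Y (t.localFrame b i) y)
    (c := fun y i => hB.coeff i y (nablaField I X Y y)) ?_ ?_ ?_ ?_ a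
  · exact fun i j => (contMDiffOn_inner (hB.contMDiffOn i) (hB.contMDiffOn j)).contMDiffAt hnhds
  · exact fun i => (contMDiffOn_koszul hV (hX.mono Set.inter_subset_left)
      (hY.mono Set.inter_subset_left) (hB.contMDiffOn i)).contMDiffAt hnhds
  · filter_upwards [hnhds] with y hy
    exact det_gram_ne_zero (hB.linearIndependent hy)
  · filter_upwards [hnhds] with y hy
    ext j
    rw [← inner_nabla (mdifferentiableAt_of_contMDiffOn hU hX hy.1)
      (mdifferentiableAt_of_contMDiffOn hU hY hy.1)
      (mdifferentiableAt_of_contMDiffOn hV (hB.contMDiffOn j) hy)]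
    change _ = inner ℝ (nablaField I X Y y) _
    conv_rhs => rw [hB.coeff_sum_eq (nablaField I X Y) hy]
    simp only [Matrix.vecMul, dotProduct, Matrix.of_apply, sum_inner, real_inner_smul_left]

end Germs


section Pullback

open VectorField

variable
  {E : Type*} [NormedAddCommGroup E] [NormedSpace ℝ E] [FiniteDimensional ℝ E]
  {H : Type*} [TopologicalSpace H] {I : ModelWithCorners ℝ E H}
  {M : Type*} [TopologicalSpace M] [ChartedSpace H M] [IsManifold I ∞ M]
  {E' : Type*} [NormedAddCommGroup E'] [NormedSpace ℝ E'] [FiniteDimensional ℝ E']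
  {H' : Type*} [TopologicalSpace H'] {J : ModelWithCorners ℝ E' H'}
  {N : Type*} [TopologicalSpace N] [ChartedSpace H' N] [IsManifold J ∞ N]
  {φ : M → N} {x : M}

/-! ### Sections along a map -/

variable (I J φ) in
/-- The section `σ` of `φ⁻¹TN` is differentiable at `x`. -/
def MDiffAlongAt (σ : Π y : M, TangentSpace J (φ y)) (x : M) : Prop :=
  MDifferentiableAt I J.tangent (fun y => (⟨φ y, σ y⟩ : TangentBundle J N)) x

variable (J φ) in
/-- The coordinates of a section of `φ⁻¹TN` in the trivialization of `TN` at `φ x`. -/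
noncomputable def coordAlong (x : M) (σ : Π y : M, TangentSpace J (φ y)) (y : M) : E' :=
  (trivializationAt E' (TangentSpace J : N → Type _) (φ x) ⟨φ y, σ y⟩).2

variable {σ σ' τ : Π y : M, TangentSpace J (φ y)}

lemma mdiffAlongAt_iff :
    MDiffAlongAt I J φ σ x ↔ MDiffAt φ x ∧ MDiffAt (coordAlong J φ x σ) x :=
  mdifferentiableAt_totalSpace ..

lemma MDiffAlongAt.congr (hσ : MDiffAlongAt I J φ σ x) (h : ∀ᶠ y in 𝓝 x, σ' y = σ y) :
    MDiffAlongAt I J φ σ' x :=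
  MDifferentiableAt.congr_of_eventuallyEq hσ (h.mono fun y hy => by simp only [hy])

lemma eventually_mem_baseSet_along (hφ : ContinuousAt φ x) :
    ∀ᶠ y in 𝓝 x, φ y ∈ (trivializationAt E' (TangentSpace J : N → Type _) (φ x)).baseSet :=
  hφ.eventually (eventually_mem_baseSet (φ x))

lemma coordAlong_eq {y : M}
    (hy : φ y ∈ (trivializationAt E' (TangentSpace J : N → Type _) (φ x)).baseSet) :
    coordAlong J φ x σ y = (trivializationAt E' (TangentSpace J : N → Type _)
      (φ x)).continuousLinearMapAt ℝ (φ y) (σ y) := by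
  rw [Trivialization.continuousLinearMapAt_apply, Trivialization.coe_linearMapAt_of_mem _ hy]
  rfl

lemma coordAlong_add (hφ : ContinuousAt φ x) :
    coordAlong J φ x (σ + σ') =ᶠ[𝓝 x] coordAlong J φ x σ + coordAlong J φ x σ' := by
  filter_upwards [eventually_mem_baseSet_along (J := J) hφ] with y hy
  simp only [Pi.add_apply, coordAlong_eq hy, map_add]

lemma coordAlong_smul (hφ : ContinuousAt φ x) (f : M → ℝ) :
    coordAlong J φ x (fun y => f y • σ y) =ᶠ[𝓝 x] f • coordAlong J φ x σ := by
  filter_upwards [eventually_mem_baseSet_along (J := J) hφ] with y hy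
  simp only [Pi.smul_apply', coordAlong_eq hy, map_smul]

lemma MDiffAlongAt.continuousAt (hσ : MDiffAlongAt I J φ σ x) : ContinuousAt φ x :=
  (mdiffAlongAt_iff.1 hσ).1.continuousAt

lemma MDiffAlongAt.add (hσ : MDiffAlongAt I J φ σ x) (hσ' : MDiffAlongAt I J φ σ' x) :
    MDiffAlongAt I J φ (σ + σ') x :=
  mdiffAlongAt_iff.2 ⟨(mdiffAlongAt_iff.1 hσ).1,
    ((mdiffAlongAt_iff.1 hσ).2.add (mdiffAlongAt_iff.1 hσ').2).congr_of_eventuallyEq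
      (coordAlong_add hσ.continuousAt)⟩

lemma MDiffAlongAt.smul (hσ : MDiffAlongAt I J φ σ x) {f : M → ℝ} (hf : MDiffAt f x) :
    MDiffAlongAt I J φ (fun y => f y • σ y) x :=
  mdiffAlongAt_iff.2 ⟨(mdiffAlongAt_iff.1 hσ).1,
    (hf.smul (mdiffAlongAt_iff.1 hσ).2).congr_of_eventuallyEq (coordAlong_smul hσ.continuousAt f)⟩

lemma mdiffAlongAt_comp (hφ : MDiffAt φ x) {Y : Π z : N, TangentSpace J z}
    (hY : MDiffAt (T% Y) (φ x)) : MDiffAlongAt I J φ (fun y => Y (φ y)) x :=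
  MDifferentiableAt.comp x hY hφ

lemma mdiffAlongAt_zero (hφ : MDiffAt φ x) :
    MDiffAlongAt I J φ (fun _ => 0) x :=
  mdiffAlongAt_comp hφ (Y := fun _ => 0) (mdifferentiableAt_zeroSection ..)

/-- Induction principle for properties of the differentiable sections along a map. -/
lemma mdiffAlongAt_induction {P : (Π y : M, TangentSpace J (φ y)) → Prop}
    (comp : ∀ Y : Π z : N, TangentSpace J z, MDiffAt (T% Y) (φ x) → P fun y => Y (φ y))
    (add : ∀ σ σ', MDiffAlongAt I J φ σ x → MDiffAlongAt I J φ σ' x → P σ → P σ' → P (σ + σ'))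
    (smul : ∀ (f : M → ℝ) σ, MDiffAt f x → MDiffAlongAt I J φ σ x → P σ → P fun y => f y • σ y)
    (congr : ∀ σ σ', MDiffAlongAt I J φ σ x → (∀ᶠ y in 𝓝 x, σ' y = σ y) → P σ → P σ')
    (hσ : MDiffAlongAt I J φ σ x) : P σ := by
  classical
  obtain ⟨hφ, hc⟩ := mdiffAlongAt_iff.1 hσ
  let t := trivializationAt E' (TangentSpace J : N → Type _) (φ x)
  let b := Module.finBasis ℝ E'
  have hx : φ x ∈ t.baseSet := FiberBundle.mem_baseSet_trivializationAt' (φ x)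
  have hB i : MDiffAt (T% (t.localFrame b i)) (φ x) :=
    (contMDiffAt_localFrame_of_mem 1 t b i hx).mdifferentiableAt (by simp)
  let s i y : ℝ := (LinearMap.toContinuousLinearMap (b.coord i)) (coordAlong J φ x σ y)
  have hs i : MDiffAt (s i) x :=
    (LinearMap.toContinuousLinearMap (b.coord i)).differentiableAt.mdifferentiableAt.comp x hc
  have key (S : Finset (Fin (Module.finrank ℝ E'))) :
      MDiffAlongAt I J φ (fun y => ∑ i ∈ S, s i y • t.localFrame b i (φ y)) x ∧
        P (fun y => ∑ i ∈ S, s i y • t.localFrame b i (φ y)) := by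
    induction S using Finset.induction_on with
    | empty =>
      simp only [Finset.sum_empty]
      exact ⟨mdiffAlongAt_zero hφ, comp (fun _ => 0) (mdifferentiableAt_zeroSection ..)⟩
    | insert i S hi ih =>
      simp only [Finset.sum_insert hi]
      have h1 := mdiffAlongAt_comp hφ (hB i)
      exact ⟨(h1.smul (hs i)).add ih.1,
        add _ _ (h1.smul (hs i)) ih.1 (smul _ _ (hs i) h1 (comp _ (hB i))) ih.2⟩
  refine congr _ σ (key Finset.univ).1 ?_ (key Finset.univ).2
  filter_upwards [eventually_mem_baseSet_along (J := J) hφ.continuousAt] with y hy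
  have h1 : σ y = t.symmL ℝ (φ y) (coordAlong J φ x σ y) := by
    rw [coordAlong_eq hy, Trivialization.symmL_continuousLinearMapAt _ hy]
  rw [h1]
  conv_lhs => rw [← b.sum_repr (coordAlong J φ x σ y)]
  rw [map_sum]
  refine Finset.sum_congr rfl fun i _ => ?_
  rw [map_smul, Trivialization.localFrame_apply_of_mem_baseSet _ _ hy]
  congr 1
  rw [Trivialization.symmL_apply _ hy]
  simp [Trivialization.basisAt]

variable [RiemannianBundle (fun y : N => TangentSpace J y)]

/-! ### The pull-back connection -/

lemma pullNabla_eq (v : TangentSpace I x) (σ : Π y : M, TangentSpace J (φ y)) :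
    pullNabla I J φ v σ = (trivializationAt E' (TangentSpace J : N → Type _) (φ x)).symmL ℝ (φ x)
      (mvfderiv I (coordAlong J φ x σ) x v) + nabla J (mfderiv I J φ x v) (extVec J (σ x)) := by
  rw [Trivialization.symmL_apply _ (FiberBundle.mem_baseSet_trivializationAt' (φ x))]
  rfl

lemma pullNabla_congr (v : TangentSpace I x) (h : ∀ᶠ y in 𝓝 x, σ y = σ' y) :
    pullNabla I J φ v σ = pullNabla I J φ v σ' := by
  have h1 : coordAlong J φ x σ =ᶠ[𝓝 x] coordAlong J φ x σ' :=
    h.mono fun y hy => by simp only [coordAlong, hy]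
  rw [pullNabla_eq, pullNabla_eq, mvfderiv_congr h1, h.self_of_nhds]

variable [IsContMDiffRiemannianBundle J ∞ E' (fun y : N => TangentSpace J y)]

lemma pullNabla_add_left (v w : TangentSpace I x) (σ : Π y : M, TangentSpace J (φ y)) :
    pullNabla I J φ (v + w) σ = pullNabla I J φ v σ + pullNabla I J φ w σ := by
  simp only [pullNabla_eq, map_add, nabla_add_left _ _ (mdifferentiableAt_extVec (σ x))]
  abel

lemma pullNabla_smul_left (c : ℝ) (v : TangentSpace I x) (σ : Π y : M, TangentSpace J (φ y)) :
    pullNabla I J φ (c • v) σ = c • pullNabla I J φ v σ := by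
  simp only [pullNabla_eq, map_smul, nabla_smul_left _ _ (mdifferentiableAt_extVec (σ x)),
    smul_add]

lemma pullNabla_add (v : TangentSpace I x) (hσ : MDiffAlongAt I J φ σ x)
    (hσ' : MDiffAlongAt I J φ σ' x) :
    pullNabla I J φ v (σ + σ') = pullNabla I J φ v σ + pullNabla I J φ v σ' := by
  rw [pullNabla_eq, pullNabla_eq, pullNabla_eq, mvfderiv_congr (coordAlong_add hσ.continuousAt),
    mvfderiv_add (mdiffAlongAt_iff.1 hσ).2 (mdiffAlongAt_iff.1 hσ').2, Pi.add_apply,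
    nabla_congr _ (extVec_add _ _), nabla_add_right _ (mdifferentiableAt_extVec _)
      (mdifferentiableAt_extVec _), add_apply, map_add]
  abel

lemma pullNabla_smul (v : TangentSpace I x) {f : M → ℝ} (hf : MDiffAt f x)
    (hσ : MDiffAlongAt I J φ σ x) :
    pullNabla I J φ v (fun y => f y • σ y)
      = f x • pullNabla I J φ v σ + dirDeriv I f v • σ x := by
  have hx : φ x ∈ (trivializationAt E' (TangentSpace J : N → Type _) (φ x)).baseSet :=
    FiberBundle.mem_baseSet_trivializationAt' (φ x)
  rw [pullNabla_eq, pullNabla_eq, mvfderiv_congr (coordAlong_smul hσ.continuousAt f),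
    mvfderiv_smul hf (mdiffAlongAt_iff.1 hσ).2,
    nabla_congr _ (extVec_smul _ _)]
  have h := nabla_smul_right (mfderiv I J φ x v) (f := fun _ => f x) mdifferentiableAt_const
    (mdifferentiableAt_extVec (σ x))
  have h0 : dirDeriv J (fun _ : N => f x) (mfderiv I J φ x v) = 0 := by
    simp [dirDeriv, mvfderiv_const]
  rw [h0, zero_smul, add_zero] at h
  have h1 : nabla J (mfderiv I J φ x v) (f x • extVec J (σ x))
    = f x • nabla J (mfderiv I J φ x v) (extVec J (σ x)) := h
  rw [h1]
  have h2 : (trivializationAt E' (TangentSpace J : N → Type _) (φ x)).symmL ℝ (φ x)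
      (coordAlong J φ x σ x) = σ x := by
    rw [coordAlong_eq hx, Trivialization.symmL_continuousLinearMapAt _ hx]
  simp only [add_apply, smul_apply, ContinuousLinearMap.smulRight_apply, map_add, map_smul, h2,
    smul_add, dirDeriv]
  abel

lemma coordAlong_id_extVec {z : N} (w : TangentSpace J z) :
    coordAlong J (id : N → N) z (extVec J w) =ᶠ[𝓝 z]
      fun _ => (trivializationAt E' (TangentSpace J : N → Type _) z).continuousLinearMapAt ℝ z w := by
  filter_upwards [eventually_mem_baseSet (I := J) z] with y hy
  rw [coordAlong_eq (φ := id) hy]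
  simp only [id]
  rw [extVec_eq _ hy, Trivialization.continuousLinearMapAt_symmL _ hy]

lemma pullNabla_id {z : N} (w : TangentSpace J z) {Y : Π z : N, TangentSpace J z}
    (hY : MDiffAt (T% Y) z) : pullNabla J J id w Y = nabla J w Y := by
  let P : (Π z : N, TangentSpace J z) → TangentSpace J z := fun Y => pullNabla J J id w Y
  have hT : TensorialAt J E' (fun Y : Π z : N, TangentSpace J z => P Y - nabla J w Y) z :=
    { smul := fun {f Y} hf hY => by
        have h : P (f • Y) = f z • P Y + dirDeriv J f w • Y z :=
          pullNabla_smul (φ := id) (J := J) (σ := Y) w hf hY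
        simp only [h, nabla_smul_right w hf hY, smul_sub]
        abel
      add := fun {Y Y'} hY hY' => by
        have h : P (Y + Y') = P Y + P Y' :=
          pullNabla_add (φ := id) (J := J) (σ := Y) (σ' := Y') w hY hY'
        simp only [h, nabla_add_right w hY hY']
        abel }
  have h := hT.pointwise hY (mdifferentiableAt_extVec (Y z)) (extVec_self _).symm
  have h0 : P (extVec J (Y z)) = nabla J w (extVec J (Y z)) := by
    simp only [P]
    rw [pullNabla_eq, mvfderiv_congr (coordAlong_id_extVec (Y z)), mvfderiv_const, zero_apply,
      map_zero, zero_add, mfderiv_id]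
    simp only [id, extVec_self]
    rfl
  rw [h0, sub_self] at h
  exact sub_eq_zero.1 h

lemma pullNabla_comp (v : TangentSpace I x) (hφ : MDiffAt φ x) {Y : Π z : N, TangentSpace J z}
    (hY : MDiffAt (T% Y) (φ x)) :
    pullNabla I J φ v (fun y => Y (φ y)) = nabla J (mfderiv I J φ x v) Y := by
  rw [← pullNabla_id _ hY, pullNabla_eq, pullNabla_eq, mfderiv_id]
  have hc : MDiffAt (coordAlong J (id : N → N) (φ x) Y) (φ x) := (mdiffAlongAt_iff.1 hY).2
  have h : mvfderiv I (coordAlong J φ x fun y => Y (φ y)) x v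
      = mvfderiv J (coordAlong J (id : N → N) (φ x) Y) (φ x) (mfderiv I J φ x v) :=
    mfderiv_comp_apply x hc hφ v
  rw [h]
  rfl

lemma mdifferentiableAt_inner_along (hσ : MDiffAlongAt I J φ σ x) (hτ : MDiffAlongAt I J φ τ x) :
    MDiffAt (fun y => inner ℝ (σ y) (τ y)) x :=
  MDifferentiableAt.inner_bundle (F := E') (E := fun x : N => TangentSpace J x) hσ hτ

lemma dirDeriv_inner_along (v : TangentSpace I x) (hσ : MDiffAlongAt I J φ σ x)
    (hτ : MDiffAlongAt I J φ τ x) :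
    dirDeriv I (fun y => inner ℝ (σ y) (τ y)) v
      = inner ℝ (pullNabla I J φ v σ) (τ x) + inner ℝ (σ x) (pullNabla I J φ v τ) := by
  have hφ : MDiffAt φ x := (mdiffAlongAt_iff.1 hσ).1
  refine mdiffAlongAt_induction (P := fun σ => dirDeriv I (fun y => inner ℝ (σ y) (τ y)) v
      = inner ℝ (pullNabla I J φ v σ) (τ x) + inner ℝ (σ x) (pullNabla I J φ v τ))
    (fun Y hY => ?_) (fun σ σ' hσ hσ' h h' => ?_) (fun f σ hf hσ h => ?_)
    (fun σ σ' hσ h h' => ?_) hσ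
  · refine mdiffAlongAt_induction (P := fun τ => dirDeriv I (fun y => inner ℝ (Y (φ y)) (τ y)) v
      = inner ℝ (pullNabla I J φ v fun y => Y (φ y)) (τ x)
        + inner ℝ (Y (φ x)) (pullNabla I J φ v τ))
      (fun Z hZ => ?_) (fun σ σ' hσ hσ' h h' => ?_) (fun f σ hf hσ h => ?_)
      (fun σ σ' hσ h h' => ?_) hτ
    · rw [pullNabla_comp v hφ hY, pullNabla_comp v hφ hZ, ← dirDeriv_inner _ hY hZ]
      exact mfderiv_comp_apply x (mdifferentiableAt_inner hY hZ) hφ v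
    · have hY' := mdiffAlongAt_comp hφ hY
      rw [pullNabla_add v hσ hσ']
      simp only [Pi.add_apply, inner_add_right, dirDeriv] at h h' ⊢
      rw [mvfderiv_fun_add (mdifferentiableAt_inner_along hY' hσ)
        (mdifferentiableAt_inner_along hY' hσ'), add_apply, h, h']
      ring
    · have hY' := mdiffAlongAt_comp hφ hY
      rw [pullNabla_smul v hf hσ]
      simp only [inner_smul_right, inner_add_right, dirDeriv] at h ⊢
      rw [mvfderiv_fun_mul hf (mdifferentiableAt_inner_along hY' hσ), add_apply, smul_apply,
        smul_apply, h]
      simp only [smul_eq_mul]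
      ring
    · have h1 : (fun y => inner ℝ (Y (φ y)) (σ' y)) =ᶠ[𝓝 x] fun y => inner ℝ (Y (φ y)) (σ y) :=
        h.mono fun y hy => by simp only [hy]
      simp only [dirDeriv] at h' ⊢
      rw [mvfderiv_congr h1, h', pullNabla_congr v h, h.self_of_nhds]
  · rw [pullNabla_add v hσ hσ']
    simp only [Pi.add_apply, inner_add_left, dirDeriv] at h h' ⊢
    rw [mvfderiv_fun_add (mdifferentiableAt_inner_along hσ hτ)
      (mdifferentiableAt_inner_along hσ' hτ), add_apply, h, h']
    ring
  · rw [pullNabla_smul v hf hσ]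
    simp only [real_inner_smul_left, inner_add_left, dirDeriv] at h ⊢
    rw [mvfderiv_fun_mul hf (mdifferentiableAt_inner_along hσ hτ), add_apply, smul_apply,
      smul_apply, h]
    simp only [smul_eq_mul]
    ring
  · have h1 : (fun y => inner ℝ (σ' y) (τ y)) =ᶠ[𝓝 x] fun y => inner ℝ (σ y) (τ y) :=
      h.mono fun y hy => by simp only [hy]
    simp only [dirDeriv] at h' ⊢
    rw [mvfderiv_congr h1, h', pullNabla_congr v h, h.self_of_nhds]

end Pullback


section Push

open VectorField

variable
  {E : Type*} [NormedAddCommGroup E] [NormedSpace ℝ E] [FiniteDimensional ℝ E]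
  {H : Type*} [TopologicalSpace H] {I : ModelWithCorners ℝ E H}
  {M : Type*} [TopologicalSpace M] [ChartedSpace H M] [IsManifold I ∞ M]
  {E' : Type*} [NormedAddCommGroup E'] [NormedSpace ℝ E'] [FiniteDimensional ℝ E']
  {H' : Type*} [TopologicalSpace H'] {J : ModelWithCorners ℝ E' H'}
  {N : Type*} [TopologicalSpace N] [ChartedSpace H' N] [IsManifold J ∞ N]
  {φ : M → N} {x : M} {X Y Z : Π y : M, TangentSpace I y}

/-! ### Push-forwards of vector fields -/

lemma mdiffAlongAt_push (hφ : ContMDiff I J ∞ φ) (hX : MDiffAt (T% X) x) :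
    MDiffAlongAt I J φ (push I J φ X) x :=
  MDifferentiableAt.comp x
    ((hφ.contMDiff_tangentMap (m := 1) (by decide)).mdifferentiableAt (by simp)) hX

lemma push_add : push I J φ (X + Y) = push I J φ X + push I J φ Y := by
  ext y
  simp [push]

lemma push_smul (f : M → ℝ) : push I J φ (f • X) = fun y => f y • push I J φ X y := by
  ext y
  simp [push]

lemma continuousLinearMapAt_self (v : TangentSpace I x) :
    (trivializationAt E (TangentSpace I : M → Type _) x).continuousLinearMapAt ℝ x v = v := by
  rw [TangentBundle.continuousLinearMapAt_trivializationAt (by simp), mfderiv_extChartAt_self]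
  rfl

lemma coordAlong_push_extVec (hφ : ContMDiff I J ∞ φ) (w : TangentSpace I x) :
    coordAlong J φ x (push I J φ (extVec I w)) =ᶠ[𝓝 x] fun y =>
      fderivWithin ℝ (writtenInExtChartAt I J x φ) (Set.range I) (extChartAt I x y) w := by
  have h1 : ∀ᶠ y in 𝓝 x, φ y ∈ (chartAt H' (φ x)).source :=
    hφ.continuous.continuousAt.eventually
      ((chartAt H' (φ x)).open_source.mem_nhds (mem_chart_source _ _))
  filter_upwards [h1, extChartAt_source_mem_nhds (I := I) x] with y hy hy'
  have hz := (extChartAt I x).map_source hy'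
  have hU : UniqueMDiffWithinAt 𝓘(ℝ, E) (Set.range I) (extChartAt I x y) :=
    I.uniqueMDiffOn _ (extChartAt_target_subset_range x hz)
  have hleft := (extChartAt I x).left_inv hy'
  rw [coordAlong_eq (by simpa using hy), TangentBundle.continuousLinearMapAt_trivializationAt hy]
  simp only [push]
  rw [extVec_eq_mfderivWithin w hy', continuousLinearMapAt_self]
  have h2 : MDifferentiableWithinAt 𝓘(ℝ, E) I (extChartAt I x).symm (Set.range I)
    (extChartAt I x y) := mdifferentiableWithinAt_extChartAt_symm hz
  have h3 : MDifferentiableAt I J φ ((extChartAt I x).symm (extChartAt I x y)) :=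
    hφ.mdifferentiableAt (by simp)
  have h4 : MDifferentiableAt J 𝓘(ℝ, E') (extChartAt J (φ x))
      (φ ((extChartAt I x).symm (extChartAt I x y))) := by
    rw [hleft]
    exact mdifferentiableAt_extChartAt hy
  have h5 := mfderiv_comp_mfderivWithin (extChartAt I x y) h3 h2 hU
  have h6 := mfderiv_comp_mfderivWithin (extChartAt I x y) h4
    (h3.comp_mdifferentiableWithinAt _ h2) hU
  have h7 : fderivWithin ℝ (writtenInExtChartAt I J x φ) (Set.range I) (extChartAt I x y)
      = mfderivWithin 𝓘(ℝ, E) 𝓘(ℝ, E') (extChartAt J (φ x) ∘ (φ ∘ (extChartAt I x).symm))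
        (Set.range I) (extChartAt I x y) := by
    rw [mfderivWithin_eq_fderivWithin]
    rfl
  rw [h7, h6, Function.comp_apply, h5, hleft]
  rfl

lemma mvfderiv_coordAlong_push_extVec (hφ : ContMDiff I J ∞ φ) (v w : E) :
    mvfderiv I (coordAlong J φ x (push I J φ (extVec I (x := x) w))) x v
      = fderivWithin ℝ (fun z => fderivWithin ℝ (writtenInExtChartAt I J x φ) (Set.range I) z)
        (Set.range I) (extChartAt I x x) v w := by
  have hF : ContDiffWithinAt ℝ ∞ (writtenInExtChartAt I J x φ) (Set.range I) (extChartAt I x x) :=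
    (contMDiffAt_iff.1 hφ.contMDiffAt).2
  have hmem : extChartAt I x x ∈ Set.range I := by simp
  have hD : DifferentiableWithinAt ℝ
      (fun z => fderivWithin ℝ (writtenInExtChartAt I J x φ) (Set.range I) z)
      (Set.range I) (extChartAt I x x) :=
    (hF.fderivWithin_right (m := 1) I.uniqueDiffOn (by decide) hmem).differentiableWithinAt
      (by simp)
  have hd : MDiffAt (coordAlong J φ x (push I J φ (extVec I (x := x) w))) x :=
    (mdiffAlongAt_iff.1 (mdiffAlongAt_push hφ (mdifferentiableAt_extVec (x := x) w))).2
  rw [hd.mvfderiv]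
  have h1 : writtenInExtChartAt I 𝓘(ℝ, E') x (coordAlong J φ x (push I J φ (extVec I (x := x) w)))
      =ᶠ[𝓝[Set.range I] (extChartAt I x x)]
      fun z => fderivWithin ℝ (writtenInExtChartAt I J x φ) (Set.range I) z w := by
    have ht : Filter.Tendsto (extChartAt I x).symm (𝓝 (extChartAt I x x)) (𝓝 x) := by
      have := (continuousAt_extChartAt_symm (I := I) x).tendsto
      rwa [extChartAt_to_inv] at this
    have h2 := ht.eventually (coordAlong_push_extVec (x := x) hφ w)
    filter_upwards [h2.filter_mono nhdsWithin_le_nhds, extChartAt_target_mem_nhdsWithin (I := I) x]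
      with z hz hz'
    simp only [writtenInExtChartAt, extChartAt_model_space_eq_id, PartialEquiv.refl_coe,
      Function.comp_apply, id]
    rw [hz, (extChartAt I x).right_inv hz']
    rfl
  rw [h1.fderivWithin_eq_of_mem hmem, fderivWithin_clm_apply (I.uniqueDiffOn _ hmem) hD
    (differentiableWithinAt_const _)]
  simp
  rfl

variable [RiemannianBundle (fun y : N => TangentSpace J y)]
  [IsContMDiffRiemannianBundle J ∞ E' (fun y : N => TangentSpace J y)]

lemma pullNabla_push_extVec_comm (hφ : ContMDiff I J ∞ φ) (v w : TangentSpace I x) :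
    pullNabla I J φ v (push I J φ (extVec I w)) = pullNabla I J φ w (push I J φ (extVec I v)) := by
  have hF : ContDiffWithinAt ℝ ∞ (writtenInExtChartAt I J x φ) (Set.range I) (extChartAt I x x) :=
    (contMDiffAt_iff.1 hφ.contMDiffAt).2
  have hmem : extChartAt I x x ∈ Set.range I := by simp
  have hs : IsSymmSndFDerivWithinAt ℝ (writtenInExtChartAt I J x φ) (Set.range I)
      (extChartAt I x x) :=
    hF.isSymmSndFDerivWithinAt (by rw [minSmoothness_of_isRCLikeNormedField]; decide) I.uniqueDiffOn
      (I.range_subset_closure_interior hmem) hmem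
  have hc : mvfderiv I (coordAlong J φ x (push I J φ (extVec I w))) x v
      = mvfderiv I (coordAlong J φ x (push I J φ (extVec I v))) x w :=
    (mvfderiv_coordAlong_push_extVec hφ v w).trans
      ((hs v w).trans (mvfderiv_coordAlong_push_extVec hφ w v).symm)
  rw [pullNabla_eq, pullNabla_eq, hc]
  congr 1
  simp only [push, extVec_self]
  have h := nabla_sub_nabla_swap (mdifferentiableAt_extVec (mfderiv I J φ x v))
    (mdifferentiableAt_extVec (mfderiv I J φ x w))
  rw [mlieBracket_extVec_extVec, extVec_self, extVec_self] at h
  exact sub_eq_zero.1 h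

lemma pullNabla_push_sub_swap (hφ : ContMDiff I J ∞ φ) (hX : MDiffAt (T% X) x)
    (hY : MDiffAt (T% Y) x) :
    pullNabla I J φ (X x) (push I J φ Y) - pullNabla I J φ (Y x) (push I J φ X)
      = mfderiv I J φ x (mlieBracket I X Y x) := by
  let T : (Π y : M, TangentSpace I y) → (Π y : M, TangentSpace I y) → TangentSpace J (φ x) :=
    fun X Y => pullNabla I J φ (X x) (push I J φ Y) - pullNabla I J φ (Y x) (push I J φ X)
      - mfderiv I J φ x (mlieBracket I X Y x)
  have hswap X Y : T X Y = - T Y X := by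
    simp only [T]
    rw [mlieBracket_swap_apply, map_neg]
    abel
  have hT X (hX : MDiffAt (T% X) x) : TensorialAt I E (T X) x :=
    { smul := fun {f Y} hf hY => by
        simp only [T]
        rw [push_smul, pullNabla_smul _ hf (mdiffAlongAt_push hφ hY), Pi.smul_apply',
          pullNabla_smul_left, mlieBracket_smul_right hf hY, map_add, map_smul, map_smul]
        simp only [push, dirDeriv, smul_sub]
        abel
      add := fun {Y Y'} hY hY' => by
        simp only [T]
        rw [push_add, pullNabla_add _ (mdiffAlongAt_push hφ hY) (mdiffAlongAt_push hφ hY'),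
          Pi.add_apply, pullNabla_add_left, mlieBracket_add_right hY hY', map_add]
        abel }
  have hT' Y (hY : MDiffAt (T% Y) x) : TensorialAt I E (fun X => T X Y) x :=
    { smul := fun {f X} hf hX => by
        rw [hswap, hswap X, (hT Y hY).smul hf hX, smul_neg]
      add := fun {X X'} hX hX' => by
        rw [hswap, hswap X, hswap X', (hT Y hY).add hX hX', neg_add] }
  have h := TensorialAt.pointwise₂ hT' hT hX (mdifferentiableAt_extVec (X x)) hY
    (mdifferentiableAt_extVec (Y x)) (extVec_self _).symm (extVec_self _).symm
  have h0 : T (extVec I (X x)) (extVec I (Y x)) = 0 := by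
    simp only [T]
    rw [mlieBracket_extVec_extVec, extVec_self, extVec_self, pullNabla_push_extVec_comm hφ,
      sub_self, map_zero, sub_zero]
  exact sub_eq_zero.1 (h.trans h0)

end Push


lemma sum_orthonormalBasis_eq {V W ι ι' : Type*} [NormedAddCommGroup V] [InnerProductSpace ℝ V]
    [AddCommGroup W] [Module ℝ W] [Fintype ι] [Fintype ι'] (B : V →ₗ[ℝ] V →ₗ[ℝ] W)
    (b : OrthonormalBasis ι ℝ V) (b' : OrthonormalBasis ι' ℝ V) :
    ∑ i, B (b i) (b i) = ∑ j, B (b' j) (b' j) := by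
  classical
  have h1 (i) : B (b i) (b i) = ∑ j, ∑ k, (inner ℝ (b' j) (b i) * inner ℝ (b i) (b' k)) •
      B (b' j) (b' k) := by
    conv_lhs => rw [← b'.sum_repr' (b i)]
    simp only [map_sum, map_smul, LinearMap.sum_apply, LinearMap.smul_apply, Finset.smul_sum,
      smul_smul]
    rw [Finset.sum_comm]
    refine Finset.sum_congr rfl fun j _ => Finset.sum_congr rfl fun k _ => ?_
    rw [real_inner_comm (b i) (b' k), mul_comm]
  simp only [h1]
  rw [Finset.sum_comm]
  refine Finset.sum_congr rfl fun j _ => ?_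
  rw [Finset.sum_comm]
  simp only [← Finset.sum_smul, b.sum_inner_mul_inner]
  rw [Finset.sum_eq_single j]
  · rw [b'.inner_eq_one, one_smul]
  · intro k _ hk
    rw [b'.inner_eq_zero hk.symm, zero_smul]
  · simp

section Submersion

open VectorField

variable
  {E : Type*} [NormedAddCommGroup E] [NormedSpace ℝ E] [FiniteDimensional ℝ E]
  {H : Type*} [TopologicalSpace H] {I : ModelWithCorners ℝ E H}
  {M : Type*} [TopologicalSpace M] [ChartedSpace H M] [IsManifold I ∞ M]
  {E' : Type*} [NormedAddCommGroup E'] [NormedSpace ℝ E'] [FiniteDimensional ℝ E']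
  {H' : Type*} [TopologicalSpace H'] {J : ModelWithCorners ℝ E' H'}
  {N : Type*} [TopologicalSpace N] [ChartedSpace H' N] [IsManifold J ∞ N]
  {φ : M → N} {x : M} {X Y Z V : Π y : M, TangentSpace I y}
  [RiemannianBundle (fun x : M => TangentSpace I x)]
  [RiemannianBundle (fun y : N => TangentSpace J y)]

/-! ### Horizontal and vertical vectors -/

lemma mem_vertical {v : TangentSpace I x} : v ∈ vertical I J φ x ↔ mfderiv I J φ x v = 0 := Iff.rfl

lemma horPart_add_verPart (X : Π y : M, TangentSpace I y) (y : M) :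
    horPart I J φ X y + verPart I J φ X y = X y := by
  rw [add_comm]
  exact (vertical I J φ y).starProjection_add_starProjection_orthogonal (X y)

lemma verPart_mem (X : Π y : M, TangentSpace I y) (y : M) :
    verPart I J φ X y ∈ vertical I J φ y := Submodule.starProjection_apply_mem _ _

lemma horPart_mem (X : Π y : M, TangentSpace I y) (y : M) :
    horPart I J φ X y ∈ horizontal I J φ y := Submodule.starProjection_apply_mem _ _

lemma mfderiv_horPart (X : Π y : M, TangentSpace I y) (y : M) :
    mfderiv I J φ y (horPart I J φ X y) = mfderiv I J φ y (X y) := by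
  conv_rhs => rw [← horPart_add_verPart (J := J) (φ := φ) X y, map_add,
    mem_vertical.1 (verPart_mem X y), add_zero]

lemma inner_mfderiv (hφ : IsRiemannianSubmersion I J φ) (v : TangentSpace I x)
    {w : TangentSpace I x} (hw : w ∈ horizontal I J φ x) :
    inner ℝ (mfderiv I J φ x v) (mfderiv I J φ x w) = inner ℝ v w := by
  have h : (vertical I J φ x).starProjection v + (horizontal I J φ x).starProjection v = v :=
    (vertical I J φ x).starProjection_add_starProjection_orthogonal v
  have h1 : (vertical I J φ x).starProjection v ∈ vertical I J φ x :=
    Submodule.starProjection_apply_mem _ _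
  rw [← h, map_add, mem_vertical.1 h1, zero_add,
    hφ.isometric x _ _ (Submodule.starProjection_apply_mem _ _) hw, inner_add_left,
    Submodule.inner_right_of_mem_orthogonal h1 hw, zero_add]

/-! ### Adapted frames -/

variable {ι κ : Type*} [Fintype ι] [Fintype κ] {U : Set M} {e : ι → Π y : M, TangentSpace I y}
  {f : κ → Π y : M, TangentSpace I y}

/-- The orthonormal basis of a tangent space given by an adapted frame. -/
noncomputable def IsAdaptedFrame.basis (hF : IsAdaptedFrame I J φ U e f) {y : M} (hy : y ∈ U) :
    OrthonormalBasis (ι ⊕ κ) ℝ (TangentSpace I y) :=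
  OrthonormalBasis.mk (hF.orthonormal y hy) (hF.span y hy).ge

lemma IsAdaptedFrame.basis_apply (hF : IsAdaptedFrame I J φ U e f) {y : M} (hy : y ∈ U)
    (a : ι ⊕ κ) : hF.basis hy a = Sum.elim (fun i => e i y) (fun s => f s y) a := by
  simp [IsAdaptedFrame.basis]

lemma IsAdaptedFrame.sum_eq (hF : IsAdaptedFrame I J φ U e f) {y : M} (hy : y ∈ U)
    (v : TangentSpace I y) :
    v = ∑ i, inner ℝ (e i y) v • e i y + ∑ s, inner ℝ (f s y) v • f s y := by
  conv_lhs => rw [← (hF.basis hy).sum_repr' v]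
  simp [Fintype.sum_sum_type, hF.basis_apply hy]

lemma IsAdaptedFrame.inner_f_of_horizontal (hF : IsAdaptedFrame I J φ U e f) {y : M} (hy : y ∈ U)
    {v : TangentSpace I y} (hv : v ∈ horizontal I J φ y) (s : κ) : inner ℝ (f s y) v = 0 :=
  Submodule.inner_right_of_mem_orthogonal (hF.vertical_f s y hy) hv

lemma IsAdaptedFrame.sum_eq_of_horizontal (hF : IsAdaptedFrame I J φ U e f) {y : M} (hy : y ∈ U)
    {v : TangentSpace I y} (hv : v ∈ horizontal I J φ y) :
    v = ∑ i, inner ℝ (e i y) v • e i y := by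
  conv_lhs => rw [hF.sum_eq hy v]
  simp [hF.inner_f_of_horizontal hy hv]

lemma IsAdaptedFrame.horPart_eq (hF : IsAdaptedFrame I J φ U e f) {y : M} (hy : y ∈ U)
    (X : Π y : M, TangentSpace I y) :
    horPart I J φ X y = ∑ i, inner ℝ (e i y) (X y) • e i y := by
  conv_lhs => rw [hF.sum_eq_of_horizontal hy (horPart_mem X y)]
  refine Finset.sum_congr rfl fun i _ => ?_
  conv_rhs => rw [← horPart_add_verPart (J := J) (φ := φ) X y, inner_add_right,
    Submodule.inner_left_of_mem_orthogonal (verPart_mem X y) (hF.horizontal_e i y hy), add_zero]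

lemma IsAdaptedFrame.verPart_eq (hF : IsAdaptedFrame I J φ U e f) {y : M} (hy : y ∈ U)
    (X : Π y : M, TangentSpace I y) :
    verPart I J φ X y = ∑ s, inner ℝ (f s y) (X y) • f s y := by
  have h := hF.sum_eq hy (X y)
  rw [← hF.horPart_eq hy] at h
  exact add_left_cancel ((horPart_add_verPart X y).trans h)

lemma IsAdaptedFrame.sum_mfderiv_eq (hF : IsAdaptedFrame I J φ U e f) {y : M} (hy : y ∈ U)
    (v : TangentSpace I y) :
    mfderiv I J φ y v = ∑ i, inner ℝ (e i y) v • mfderiv I J φ y (e i y) := by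
  conv_lhs => rw [hF.sum_eq hy v]
  simp [map_sum, mem_vertical.1 (hF.vertical_f _ y hy)]

/-- The orthonormal basis of `T_{φ y} N` given by the horizontal vectors of an adapted frame. -/
noncomputable def IsAdaptedFrame.basisMap (hF : IsAdaptedFrame I J φ U e f)
    (hφ : IsRiemannianSubmersion I J φ) {y : M} (hy : y ∈ U) :
    OrthonormalBasis ι ℝ (TangentSpace J (φ y)) :=
  OrthonormalBasis.mk (v := fun i => mfderiv I J φ y (e i y))
    (by
      classical
      have h := (hF.orthonormal y hy).comp _ Sum.inl_injective
      rw [orthonormal_iff_ite] at h ⊢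
      intro i j
      rw [inner_mfderiv hφ _ (hF.horizontal_e j y hy)]
      exact h i j)
    (by
      intro w _
      obtain ⟨v, rfl⟩ := hφ.surjective y w
      rw [hF.sum_mfderiv_eq hy v]
      exact Submodule.sum_mem _ fun i _ =>
        Submodule.smul_mem _ _ (Submodule.subset_span ⟨i, rfl⟩))

lemma IsAdaptedFrame.basisMap_apply (hF : IsAdaptedFrame I J φ U e f)
    (hφ : IsRiemannianSubmersion I J φ) {y : M} (hy : y ∈ U) (i : ι) :
    hF.basisMap hφ hy i = mfderiv I J φ y (e i y) := by
  simp [IsAdaptedFrame.basisMap]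

variable [IsContMDiffRiemannianBundle I ∞ E (fun x : M => TangentSpace I x)]
  [IsContMDiffRiemannianBundle J ∞ E' (fun y : N => TangentSpace J y)]

lemma IsAdaptedFrame.contMDiffOn_horPart (hF : IsAdaptedFrame I J φ U e f)
    (hX : CMDiff[U] ∞ (T% X)) : CMDiff[U] ∞ (T% (horPart I J φ X)) := by
  have h : CMDiff[U] ∞ (T% (fun y => ∑ i, inner ℝ (e i y) (X y) • e i y)) :=
    ContMDiffOn.sum_section fun i _ =>
      (contMDiffOn_inner (hF.smooth_e i) hX).smul_section (hF.smooth_e i)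
  exact h.congr fun y hy => by rw [hF.horPart_eq hy]

lemma IsAdaptedFrame.contMDiffOn_verPart (hF : IsAdaptedFrame I J φ U e f)
    (hX : CMDiff[U] ∞ (T% X)) : CMDiff[U] ∞ (T% (verPart I J φ X)) := by
  have h : CMDiff[U] ∞ (T% (fun y => ∑ s, inner ℝ (f s y) (X y) • f s y)) :=
    ContMDiffOn.sum_section fun s _ =>
      (contMDiffOn_inner (hF.smooth_f s) hX).smul_section (hF.smooth_f s)
  exact h.congr fun y hy => by rw [hF.verPart_eq hy]

lemma IsAdaptedFrame.mdifferentiableAt_e (hF : IsAdaptedFrame I J φ U e f) (hx : x ∈ U) (i : ι) :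
    MDiffAt (T% (e i)) x := mdifferentiableAt_of_contMDiffOn hF.isOpen (hF.smooth_e i) hx

lemma IsAdaptedFrame.mdifferentiableAt_f (hF : IsAdaptedFrame I J φ U e f) (hx : x ∈ U) (s : κ) :
    MDiffAt (T% (f s)) x := mdifferentiableAt_of_contMDiffOn hF.isOpen (hF.smooth_f s) hx

/-! ### The pull-back connection of a Riemannian submersion -/

lemma inner_pullNabla_push (hφ : IsRiemannianSubmersion I J φ)
    (hX : MDiffAt (T% X) x) (hY : MDiffAt (T% Y) x) (hZ : MDiffAt (T% Z) x)
    (hX' : ∀ᶠ y in 𝓝 x, X y ∈ horizontal I J φ y) (hY' : ∀ᶠ y in 𝓝 x, Y y ∈ horizontal I J φ y)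
    (hZ' : ∀ᶠ y in 𝓝 x, Z y ∈ horizontal I J φ y) :
    inner ℝ (pullNabla I J φ (X x) (push I J φ Y)) (mfderiv I J φ x (Z x)) = koszul I X Y Z x := by
  have metric {Y Z : Π y : M, TangentSpace I y} (v : TangentSpace I x) (hY : MDiffAt (T% Y) x)
      (hZ : MDiffAt (T% Z) x) (hZ' : ∀ᶠ y in 𝓝 x, Z y ∈ horizontal I J φ y) :
      dirDeriv I (fun y => inner ℝ (Y y) (Z y)) v
        = inner ℝ (pullNabla I J φ v (push I J φ Y)) (mfderiv I J φ x (Z x))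
          + inner ℝ (pullNabla I J φ v (push I J φ Z)) (mfderiv I J φ x (Y x)) := by
    have h := dirDeriv_inner_along v (mdiffAlongAt_push hφ.smooth hY)
      (mdiffAlongAt_push hφ.smooth hZ)
    rw [real_inner_comm (pullNabla I J φ v (push I J φ Z))] at h
    refine Eq.trans ?_ h
    simp only [dirDeriv]
    rw [mvfderiv_congr]
    filter_upwards [hZ'] with y hy
    exact (inner_mfderiv hφ _ hy).symm
  have torsion {X Y Z : Π y : M, TangentSpace I y} (hX : MDiffAt (T% X) x)
      (hY : MDiffAt (T% Y) x) (hZ' : ∀ᶠ y in 𝓝 x, Z y ∈ horizontal I J φ y) :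
      inner ℝ (pullNabla I J φ (X x) (push I J φ Y)) (mfderiv I J φ x (Z x))
        - inner ℝ (pullNabla I J φ (Y x) (push I J φ X)) (mfderiv I J φ x (Z x))
        = inner ℝ (mlieBracket I X Y x) (Z x) := by
    rw [← inner_sub_left, pullNabla_push_sub_swap hφ.smooth hX hY,
      inner_mfderiv hφ _ hZ'.self_of_nhds]
  have m1 := metric (X x) hY hZ hZ'
  have m2 := metric (Y x) hX hZ hZ'
  have m3 := metric (Z x) hX hY hY'
  have t1 := torsion hX hY hZ'
  have t2 := torsion hX hZ hY'
  have t3 := torsion hY hZ hX'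
  rw [koszul, m1, m2, m3, ← t1, ← t2, ← t3]
  ring

lemma pullNabla_eq_zero_of_eventually_eq_zero (hφ : MDiffAt φ x) (v : TangentSpace I x)
    {σ : Π y : M, TangentSpace J (φ y)} (h : ∀ᶠ y in 𝓝 x, σ y = 0) :
    pullNabla I J φ v σ = 0 := by
  rw [pullNabla_congr v h]
  have h0 := pullNabla_add v (mdiffAlongAt_zero (J := J) hφ) (mdiffAlongAt_zero (J := J) hφ)
  have h1 : ((fun _ => 0 : Π y : M, TangentSpace J (φ y)) + fun _ => 0) = fun _ => 0 := by
    ext y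
    simp
  rw [h1] at h0
  exact left_eq_add.1 h0

lemma pullNabla_push_vertical (hφ : MDiffAt φ x) (v : TangentSpace I x)
    (hV : ∀ᶠ y in 𝓝 x, V y ∈ vertical I J φ y) : pullNabla I J φ v (push I J φ V) = 0 :=
  pullNabla_eq_zero_of_eventually_eq_zero hφ v (hV.mono fun _ hy => mem_vertical.1 hy)

lemma pullNabla_push_of_vertical (hφ : ContMDiff I J ∞ φ) (hV : MDiffAt (T% V) x)
    (hZ : MDiffAt (T% Z) x) (hV' : ∀ᶠ y in 𝓝 x, V y ∈ vertical I J φ y) :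
    pullNabla I J φ (V x) (push I J φ Z) = mfderiv I J φ x (mlieBracket I V Z x) := by
  rw [← pullNabla_push_sub_swap hφ hV hZ, pullNabla_push_vertical
    (hφ.mdifferentiableAt (by simp)) (Z x) hV', sub_zero]

/-! ### The second fundamental form and the tension field -/

lemma secondFundForm_eq (hφ : ContMDiff I J ∞ φ) (v : TangentSpace I x) (hY : MDiffAt (T% Y) x) :
    secondFundForm I J φ v (Y x)
      = pullNabla I J φ v (push I J φ Y) - mfderiv I J φ x (nabla I v Y) := by
  have hT : TensorialAt I E (fun Y : Π y : M, TangentSpace I y =>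
      pullNabla I J φ v (push I J φ Y) - mfderiv I J φ x (nabla I v Y)) x :=
    { smul := fun {f Y} hf hY => by
        simp only [push_smul]
        rw [pullNabla_smul v hf (mdiffAlongAt_push hφ hY), nabla_smul_right v hf hY, map_add,
          map_smul, map_smul, smul_sub]
        simp only [push]
        abel
      add := fun {Y Y'} hY hY' => by
        simp only [push_add]
        rw [pullNabla_add v (mdiffAlongAt_push hφ hY) (mdiffAlongAt_push hφ hY'),
          nabla_add_right v hY hY', map_add]
        abel }
  exact hT.pointwise (mdifferentiableAt_extVec (Y x)) hY (extVec_self _)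

/-- The second fundamental form of a smooth map at a point as a bilinear map. -/
noncomputable def secondFundFormₗ (hφ : ContMDiff I J ∞ φ) (x : M) :
    TangentSpace I x →ₗ[ℝ] TangentSpace I x →ₗ[ℝ] TangentSpace J (φ x) :=
  LinearMap.mk₂ ℝ (secondFundForm I J φ)
    (fun v v' w => by
      simp only [secondFundForm, pullNabla_add_left,
        nabla_add_left _ _ (mdifferentiableAt_extVec w), map_add]
      abel)
    (fun c v w => by
      simp only [secondFundForm, pullNabla_smul_left,
        nabla_smul_left _ _ (mdifferentiableAt_extVec w), map_smul, smul_sub])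
    (fun v w w' => by
      have h := secondFundForm_eq hφ v (mdifferentiableAt_add_section
        (mdifferentiableAt_extVec w) (mdifferentiableAt_extVec w'))
      simp only [Pi.add_apply, extVec_self] at h
      rw [h]
      simp only [secondFundForm]
      rw [push_add, pullNabla_add v (mdiffAlongAt_push hφ (mdifferentiableAt_extVec w))
        (mdiffAlongAt_push hφ (mdifferentiableAt_extVec w')),
        nabla_add_right v (mdifferentiableAt_extVec w) (mdifferentiableAt_extVec w'), map_add]
      abel)
    (fun c v w => by
      have hc : MDiffAt (fun _ : M => c) x := mdifferentiableAt_const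
      have h := secondFundForm_eq hφ v (hc.smul_section (mdifferentiableAt_extVec w))
      simp only [Pi.smul_apply', extVec_self] at h
      rw [h]
      simp only [secondFundForm]
      rw [push_smul, pullNabla_smul v hc (mdiffAlongAt_push hφ (mdifferentiableAt_extVec w)),
        nabla_smul_right v hc (mdifferentiableAt_extVec w), map_add, map_smul, map_smul, smul_sub]
      simp only [push]
      abel)

lemma secondFundForm_of_horizontal (hφ : IsRiemannianSubmersion I J φ)
    (hF : IsAdaptedFrame I J φ U e f) (hx : x ∈ U) {v w : TangentSpace I x}
    (hv : v ∈ horizontal I J φ x) (hw : w ∈ horizontal I J φ x) :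
    secondFundForm I J φ v w = 0 := by
  have hU : ∀ᶠ y in 𝓝 x, y ∈ U := hF.isOpen.mem_nhds hx
  have key (i j : ι) : secondFundFormₗ hφ.smooth x (e i x) (e j x) = 0 := by
    change secondFundForm I J φ (e i x) (e j x) = 0
    rw [secondFundForm_eq hφ.smooth _ (hF.mdifferentiableAt_e hx j)]
    refine InnerProductSpace.ext_inner_right_basis (hF.basisMap hφ hx).toBasis fun k => ?_
    rw [OrthonormalBasis.coe_toBasis, hF.basisMap_apply hφ hx, inner_zero_left, inner_sub_left,
      inner_pullNabla_push hφ (hF.mdifferentiableAt_e hx i) (hF.mdifferentiableAt_e hx j)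
        (hF.mdifferentiableAt_e hx k) (hU.mono fun y hy => hF.horizontal_e i y hy)
        (hU.mono fun y hy => hF.horizontal_e j y hy) (hU.mono fun y hy => hF.horizontal_e k y hy),
      inner_mfderiv hφ _ (hF.horizontal_e k x hx),
      inner_nabla (hF.mdifferentiableAt_e hx i) (hF.mdifferentiableAt_e hx j)
        (hF.mdifferentiableAt_e hx k), sub_self]
  change secondFundFormₗ hφ.smooth x v w = 0
  rw [hF.sum_eq_of_horizontal hx hv, hF.sum_eq_of_horizontal hx hw]
  simp [map_sum, LinearMap.sum_apply, key]

lemma pullNabla_push_of_horizontal (hφ : IsRiemannianSubmersion I J φ)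
    (hF : IsAdaptedFrame I J φ U e f) (hx : x ∈ U) {v : TangentSpace I x}
    (hv : v ∈ horizontal I J φ x) (hY : MDiffAt (T% Y) x) (hY' : Y x ∈ horizontal I J φ x) :
    pullNabla I J φ v (push I J φ Y) = mfderiv I J φ x (nabla I v Y) := by
  rw [← sub_eq_zero, ← secondFundForm_eq hφ.smooth v hY,
    secondFundForm_of_horizontal hφ hF hx hv hY']

lemma tension_eq (hφ : IsRiemannianSubmersion I J φ) (hF : IsAdaptedFrame I J φ U e f)
    (hx : x ∈ U) :
    tension I J φ x
      = -mfderiv I J φ x (∑ s, horPart I J φ (nablaField I (f s) (f s)) x) := by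
  have hU : ∀ᶠ y in 𝓝 x, y ∈ U := hF.isOpen.mem_nhds hx
  have h := sum_orthonormalBasis_eq (secondFundFormₗ hφ.smooth x)
    (stdOrthonormalBasis ℝ (TangentSpace I x)) (hF.basis hx)
  have h1 (i) : secondFundFormₗ hφ.smooth x (e i x) (e i x) = 0 :=
    secondFundForm_of_horizontal hφ hF hx (hF.horizontal_e i x hx) (hF.horizontal_e i x hx)
  have h2 (s) : secondFundFormₗ hφ.smooth x (f s x) (f s x)
      = -mfderiv I J φ x (horPart I J φ (nablaField I (f s) (f s)) x) := by
    change secondFundForm I J φ (f s x) (f s x) = _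
    rw [secondFundForm_eq hφ.smooth _ (hF.mdifferentiableAt_f hx s),
      pullNabla_push_vertical (hφ.smooth.mdifferentiableAt (by simp)) _
        (hU.mono fun y hy => hF.vertical_f s y hy), zero_sub, mfderiv_horPart]
    rfl
  refine Eq.trans ?_ (h.trans ?_)
  · rfl
  · simp only [Fintype.sum_sum_type, hF.basis_apply hx, Sum.elim_inl, Sum.elim_inr, h1, h2,
      Finset.sum_const_zero, zero_add, map_sum, Finset.sum_neg_distrib]

end Submersion


section SecondDerivative

open VectorField

variable
  {E : Type*} [NormedAddCommGroup E] [NormedSpace ℝ E] [FiniteDimensional ℝ E]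
  {H : Type*} [TopologicalSpace H] {I : ModelWithCorners ℝ E H}
  {M : Type*} [TopologicalSpace M] [ChartedSpace H M] [IsManifold I ∞ M]
  {E' : Type*} [NormedAddCommGroup E'] [NormedSpace ℝ E'] [FiniteDimensional ℝ E']
  {H' : Type*} [TopologicalSpace H'] {J : ModelWithCorners ℝ E' H'}
  {N : Type*} [TopologicalSpace N] [ChartedSpace H' N] [IsManifold J ∞ N]
  {φ : M → N} {x : M} {X Y Z V W μ : Π y : M, TangentSpace I y}
  [RiemannianBundle (fun x : M => TangentSpace I x)]
  [RiemannianBundle (fun y : N => TangentSpace J y)]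
  {ι κ : Type*} [Fintype ι] [Fintype κ] {U : Set M} {e : ι → Π y : M, TangentSpace I y}
  {f : κ → Π y : M, TangentSpace I y}
  [IsContMDiffRiemannianBundle I ∞ E (fun x : M => TangentSpace I x)]
  [IsContMDiffRiemannianBundle J ∞ E' (fun y : N => TangentSpace J y)]
  {σ σ' : Π y : M, TangentSpace J (φ y)}

/-! ### The second covariant derivative -/

variable (I J) in
/-- The section `σ` has differentiable covariant derivatives at `x`. -/
def HasMDiffPullNablaAt (σ : Π y : M, TangentSpace J (φ y)) (x : M) : Prop :=
  ∀ W : Π y : M, TangentSpace I y, MDiffAt (T% W) x →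
    MDiffAlongAt I J φ (fun y => pullNabla I J φ (W y) σ) x

lemma secondCovDeriv_eq (hσ : HasMDiffPullNablaAt I J σ x) (v : TangentSpace I x)
    (hW : MDiffAt (T% W) x) :
    secondCovDeriv I J φ v (W x) σ = pullNabla I J φ v (fun y => pullNabla I J φ (W y) σ)
      - pullNabla I J φ (nabla I v W) σ := by
  have hT : TensorialAt I E (fun W : Π y : M, TangentSpace I y =>
      pullNabla I J φ v (fun y => pullNabla I J φ (W y) σ)
        - pullNabla I J φ (nabla I v W) σ) x :=
    { smul := fun {g W} hg hW => by
        simp only [Pi.smul_apply', pullNabla_smul_left]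
        rw [pullNabla_smul v hg (hσ W hW), nabla_smul_right v hg hW, pullNabla_add_left,
          pullNabla_smul_left, pullNabla_smul_left, smul_sub]
        abel
      add := fun {W W'} hW hW' => by
        simp only [Pi.add_apply, pullNabla_add_left]
        have h := pullNabla_add v (hσ W hW) (hσ W' hW')
        have h' : pullNabla I J φ v (fun y => pullNabla I J φ (W y) σ + pullNabla I J φ (W' y) σ)
          = _ := h
        rw [h', nabla_add_right v hW hW', pullNabla_add_left]
        abel }
  exact hT.pointwise (mdifferentiableAt_extVec (W x)) hW (extVec_self _)

/-- The second covariant derivative of a section along a map as a bilinear map. -/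
noncomputable def secondCovDerivₗ (hσ : HasMDiffPullNablaAt I J σ x) :
    TangentSpace I x →ₗ[ℝ] TangentSpace I x →ₗ[ℝ] TangentSpace J (φ x) :=
  LinearMap.mk₂ ℝ (fun v w => secondCovDeriv I J φ v w σ)
    (fun v v' w => by
      simp only [secondCovDeriv, pullNabla_add_left,
        nabla_add_left _ _ (mdifferentiableAt_extVec w)]
      abel)
    (fun c v w => by
      simp only [secondCovDeriv, pullNabla_smul_left,
        nabla_smul_left _ _ (mdifferentiableAt_extVec w), smul_sub])
    (fun v w w' => by
      have hw := mdifferentiableAt_extVec w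
      have hw' := mdifferentiableAt_extVec w'
      have h := secondCovDeriv_eq hσ v (mdifferentiableAt_add_section hw hw')
      simp only [Pi.add_apply, extVec_self, pullNabla_add_left] at h
      have h' : pullNabla I J φ v (fun y => pullNabla I J φ (extVec I w y) σ
        + pullNabla I J φ (extVec I w' y) σ) = _ := pullNabla_add v (hσ _ hw) (hσ _ hw')
      rw [h, h', nabla_add_right v hw hw', pullNabla_add_left]
      simp only [secondCovDeriv]
      abel)
    (fun c v w => by
      have hc : MDiffAt (fun _ : M => c) x := mdifferentiableAt_const
      have hw := mdifferentiableAt_extVec w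
      have h := secondCovDeriv_eq hσ v (hc.smul_section hw)
      simp only [Pi.smul_apply', extVec_self, pullNabla_smul_left] at h
      rw [h, pullNabla_smul v hc (hσ _ hw), nabla_smul_right v hc hw, pullNabla_add_left,
        pullNabla_smul_left, pullNabla_smul_left]
      simp only [secondCovDeriv, smul_sub, extVec_self]
      abel)

lemma secondCovDeriv_congr (v w : TangentSpace I x) (h : ∀ᶠ y in 𝓝 x, σ y = σ' y) :
    secondCovDeriv I J φ v w σ = secondCovDeriv I J φ v w σ' := by
  simp only [secondCovDeriv]
  rw [pullNabla_congr _ h, pullNabla_congr v (h.eventually_nhds.mono fun y hy =>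
    pullNabla_congr (extVec I w y) hy)]

lemma pullNabla_const_smul (v : TangentSpace I x) (c : ℝ) (hσ : MDiffAlongAt I J φ σ x) :
    pullNabla I J φ v (fun y => c • σ y) = c • pullNabla I J φ v σ := by
  have h := pullNabla_smul v (f := fun _ => c) mdifferentiableAt_const hσ
  simpa [dirDeriv, mvfderiv_const] using h

lemma secondCovDeriv_const_smul (v w : TangentSpace I x) (c : ℝ)
    (hσ : ∀ᶠ y in 𝓝 x, MDiffAlongAt I J φ σ y) (hσ' : HasMDiffPullNablaAt I J σ x) :
    secondCovDeriv I J φ v w (fun y => c • σ y) = c • secondCovDeriv I J φ v w σ := by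
  simp only [secondCovDeriv]
  rw [pullNabla_const_smul _ c hσ.self_of_nhds, pullNabla_congr v (hσ.mono fun y hy =>
    pullNabla_const_smul (extVec I w y) c hy),
    pullNabla_const_smul v c (hσ' _ (mdifferentiableAt_extVec w)), smul_sub]

/-! ### Covariant derivatives of the push-forward of a horizontal field -/

/-- The covariant derivative of a section along a map as a linear map in the direction. -/
noncomputable def pullNablaₗ (x : M) (σ : Π y : M, TangentSpace J (φ y)) :
    TangentSpace I x →ₗ[ℝ] TangentSpace J (φ x) where
  toFun v := pullNabla I J φ v σ
  map_add' v w := pullNabla_add_left v w σ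
  map_smul' c v := pullNabla_smul_left c v σ

lemma IsAdaptedFrame.pullNabla_push_e (hF : IsAdaptedFrame I J φ U e f)
    (hφ : IsRiemannianSubmersion I J φ) (hx : x ∈ U) (hμ : CMDiff[U] ∞ (T% μ))
    (hμ' : ∀ y ∈ U, μ y ∈ horizontal I J φ y) (i : ι) :
    pullNabla I J φ (e i x) (push I J φ μ) = push I J φ (nablaField I (e i) μ) x :=
  pullNabla_push_of_horizontal hφ hF hx (hF.horizontal_e i x hx)
    (mdifferentiableAt_of_contMDiffOn hF.isOpen hμ hx) (hμ' x hx)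

lemma IsAdaptedFrame.pullNabla_push_f (hF : IsAdaptedFrame I J φ U e f)
    (hφ : IsRiemannianSubmersion I J φ) (hx : x ∈ U) (hμ : MDiffAt (T% μ) x) (s : κ) :
    pullNabla I J φ (f s x) (push I J φ μ) = push I J φ (mlieBracket I (f s) μ) x :=
  pullNabla_push_of_vertical hφ.smooth (hF.mdifferentiableAt_f hx s) hμ
    (Filter.mem_of_superset (hF.isOpen.mem_nhds hx) fun y hy => hF.vertical_f s y hy)

lemma IsAdaptedFrame.hasMDiffPullNablaAt_push (hF : IsAdaptedFrame I J φ U e f)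
    (hφ : IsRiemannianSubmersion I J φ) (hx : x ∈ U) (hμ : CMDiff[U] ∞ (T% μ))
    (hμ' : ∀ y ∈ U, μ y ∈ horizontal I J φ y) :
    HasMDiffPullNablaAt I J (push I J φ μ) x := by
  intro W hW
  have hG : MDiffAt (T% (fun y => ∑ i, inner ℝ (e i y) (W y) • nablaField I (e i) μ y
      + ∑ s, inner ℝ (f s y) (W y) • mlieBracket I (f s) μ y)) x := by
    refine mdifferentiableAt_add_section (MDifferentiableAt.sum_section fun i _ => ?_)
      (MDifferentiableAt.sum_section fun s _ => ?_)
    · exact (mdifferentiableAt_inner (hF.mdifferentiableAt_e hx i) hW).smul_section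
        (mdifferentiableAt_of_contMDiffOn hF.isOpen
          (contMDiffOn_nablaField hF.isOpen (hF.smooth_e i) hμ) hx)
    · exact (mdifferentiableAt_inner (hF.mdifferentiableAt_f hx s) hW).smul_section
        (mdifferentiableAt_of_contMDiffOn hF.isOpen
          (contMDiffOn_mlieBracket hF.isOpen (hF.smooth_f s) hμ) hx)
  refine (mdiffAlongAt_push hφ.smooth hG).congr ?_
  filter_upwards [hF.isOpen.mem_nhds hx] with y hy
  have hμy := mdifferentiableAt_of_contMDiffOn hF.isOpen hμ hy
  change pullNablaₗ y (push I J φ μ) (W y) = _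
  conv_lhs => rw [hF.sum_eq hy (W y)]
  have h1 (i) : pullNablaₗ y (push I J φ μ) (e i y) = push I J φ (nablaField I (e i) μ) y :=
    hF.pullNabla_push_e hφ hy hμ hμ' i
  have h2 (s) : pullNablaₗ y (push I J φ μ) (f s y) = push I J φ (mlieBracket I (f s) μ) y :=
    hF.pullNabla_push_f hφ hy hμy s
  simp only [map_add, map_sum, map_smul, h1, h2, push]

/-- The covariant derivative along a smooth field in terms of its horizontal and vertical parts. -/
lemma IsAdaptedFrame.pullNabla_push_eq (hF : IsAdaptedFrame I J φ U e f)
    (hφ : IsRiemannianSubmersion I J φ) (hx : x ∈ U) (hμ : CMDiff[U] ∞ (T% μ))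
    (hμ' : ∀ y ∈ U, μ y ∈ horizontal I J φ y) (hX : CMDiff[U] ∞ (T% X)) :
    pullNabla I J φ (X x) (push I J φ μ) = mfderiv I J φ x (nabla I (horPart I J φ X x) μ)
      - mfderiv I J φ x (mlieBracket I μ (verPart I J φ X) x) := by
  have hμx := mdifferentiableAt_of_contMDiffOn hF.isOpen hμ hx
  conv_lhs => rw [← horPart_add_verPart (J := J) (φ := φ) X x]
  rw [pullNabla_add_left, pullNabla_push_of_horizontal hφ hF hx (horPart_mem X x) hμx (hμ' x hx),
    pullNabla_push_of_vertical hφ.smooth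
      (mdifferentiableAt_of_contMDiffOn hF.isOpen (hF.contMDiffOn_verPart hX) hx) hμx
      (Filter.Eventually.of_forall fun y => verPart_mem X y), mlieBracket_swap_apply, map_neg,
    sub_eq_add_neg]

lemma IsAdaptedFrame.secondCovDeriv_push_e (hF : IsAdaptedFrame I J φ U e f)
    (hφ : IsRiemannianSubmersion I J φ) (hx : x ∈ U) (hμ : CMDiff[U] ∞ (T% μ))
    (hμ' : ∀ y ∈ U, μ y ∈ horizontal I J φ y) (i : ι) :
    secondCovDeriv I J φ (e i x) (e i x) (push I J φ μ)
      = mfderiv I J φ x (nabla I (e i x) (horPart I J φ (nablaField I (e i) μ))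
        - nabla I (horPart I J φ (nablaField I (e i) (e i)) x) μ
        + mlieBracket I μ (verPart I J φ (nablaField I (e i) (e i))) x) := by
  rw [secondCovDeriv_eq (hF.hasMDiffPullNablaAt_push hφ hx hμ hμ') _ (hF.mdifferentiableAt_e hx i)]
  have h1 : ∀ᶠ y in 𝓝 x, pullNabla I J φ (e i y) (push I J φ μ)
      = push I J φ (horPart I J φ (nablaField I (e i) μ)) y := by
    filter_upwards [hF.isOpen.mem_nhds hx] with y hy
    rw [hF.pullNabla_push_e hφ hy hμ hμ' i, push, push, mfderiv_horPart]
  have h2 := hF.pullNabla_push_eq hφ hx hμ hμ'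
    (contMDiffOn_nablaField hF.isOpen (hF.smooth_e i) (hF.smooth_e i))
  have h3 : pullNabla I J φ (nabla I (e i x) (e i)) (push I J φ μ) = _ := h2
  rw [pullNabla_congr _ h1, h3, pullNabla_push_of_horizontal hφ hF hx (hF.horizontal_e i x hx)
    (mdifferentiableAt_of_contMDiffOn hF.isOpen (hF.contMDiffOn_horPart
      (contMDiffOn_nablaField hF.isOpen (hF.smooth_e i) hμ)) hx) (horPart_mem _ x), map_add,
    map_sub]
  abel

lemma mlieBracket_mlieBracket_swap (hX : MDiffAt (T% (mlieBracket I Y X)) x) :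
    mlieBracket I X (mlieBracket I X Y) x = mlieBracket I (mlieBracket I Y X) X x := by
  have h : mlieBracket I X Y = fun y => (-1 : ℝ) • mlieBracket I Y X y := by
    ext y
    rw [mlieBracket_swap_apply, neg_one_smul]
  have h2 := mlieBracket_const_smul_right (c := (-1 : ℝ)) (V := X) hX
  rw [h]
  refine h2.trans ?_
  rw [mlieBracket_swap_apply (V := X), neg_one_smul, neg_neg]

lemma IsAdaptedFrame.secondCovDeriv_push_f (hF : IsAdaptedFrame I J φ U e f)
    (hφ : IsRiemannianSubmersion I J φ) (hx : x ∈ U) (hμ : CMDiff[U] ∞ (T% μ))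
    (hμ' : ∀ y ∈ U, μ y ∈ horizontal I J φ y) (s : κ) :
    secondCovDeriv I J φ (f s x) (f s x) (push I J φ μ)
      = mfderiv I J φ x (mlieBracket I (mlieBracket I μ (f s)) (f s) x
        + mlieBracket I μ (verPart I J φ (nablaField I (f s) (f s))) x
        - nabla I (horPart I J φ (nablaField I (f s) (f s)) x) μ) := by
  rw [secondCovDeriv_eq (hF.hasMDiffPullNablaAt_push hφ hx hμ hμ') _ (hF.mdifferentiableAt_f hx s)]
  have h1 : ∀ᶠ y in 𝓝 x, pullNabla I J φ (f s y) (push I J φ μ)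
      = push I J φ (mlieBracket I (f s) μ) y := by
    filter_upwards [hF.isOpen.mem_nhds hx] with y hy
    exact hF.pullNabla_push_f hφ hy (mdifferentiableAt_of_contMDiffOn hF.isOpen hμ hy) s
  have h2 := hF.pullNabla_push_eq hφ hx hμ hμ'
    (contMDiffOn_nablaField hF.isOpen (hF.smooth_f s) (hF.smooth_f s))
  have h3 : pullNabla I J φ (nabla I (f s x) (f s)) (push I J φ μ) = _ := h2
  rw [pullNabla_congr _ h1, h3, hF.pullNabla_push_f hφ hx
    (mdifferentiableAt_of_contMDiffOn hF.isOpen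
      (contMDiffOn_mlieBracket hF.isOpen (hF.smooth_f s) hμ) hx), push,
    mlieBracket_mlieBracket_swap (mdifferentiableAt_of_contMDiffOn hF.isOpen
      (contMDiffOn_mlieBracket hF.isOpen hμ (hF.smooth_f s)) hx), map_sub, map_add]
  abel

end SecondDerivative


section Curvature

open VectorField

variable
  {E : Type*} [NormedAddCommGroup E] [NormedSpace ℝ E] [FiniteDimensional ℝ E]
  {H : Type*} [TopologicalSpace H] {I : ModelWithCorners ℝ E H}
  {M : Type*} [TopologicalSpace M] [ChartedSpace H M] [IsManifold I ∞ M]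
  [RiemannianBundle (fun x : M => TangentSpace I x)]
  [IsContMDiffRiemannianBundle I ∞ E (fun x : M => TangentSpace I x)]
  {x : M} {X Y Z : Π y : M, TangentSpace I y}

/-! ### The curvature tensor -/

lemma curvature_eq (u v w : TangentSpace I x) :
    curvature I u v w = nabla I u (nablaField I (extVec I v) (extVec I w))
      - nabla I v (nablaField I (extVec I u) (extVec I w)) := by
  have h := nabla_smul_left (0 : ℝ) (0 : TangentSpace I x) (mdifferentiableAt_extVec w)
  rw [zero_smul, zero_smul] at h
  rw [curvature, mlieBracket_extVec_extVec, h, sub_zero]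

lemma curvature_swap (u v w : TangentSpace I x) : curvature I u v w = -curvature I v u w := by
  simp only [curvature_eq, neg_sub]

lemma mdifferentiableAt_nablaField_extVec (v w : TangentSpace I x) :
    MDiffAt (T% (nablaField I (extVec I v) (extVec I w))) x :=
  mdifferentiableAt_of_contMDiffOn (trivializationAt E (TangentSpace I : M → Type _) x).open_baseSet
    (contMDiffOn_nablaField (trivializationAt E (TangentSpace I : M → Type _) x).open_baseSet
      (contMDiffOn_extVec v) (contMDiffOn_extVec w)) (FiberBundle.mem_baseSet_trivializationAt' x)

lemma eventually_mdifferentiableAt_extVec (v : TangentSpace I x) :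
    ∀ᶠ y in 𝓝 x, MDiffAt (T% (extVec I v)) y :=
  (eventually_mem_baseSet (I := I) x).mono fun _ hy => mdifferentiableAt_of_contMDiffOn
    (trivializationAt E (TangentSpace I : M → Type _) x).open_baseSet (contMDiffOn_extVec v) hy

lemma nablaField_extVec_add_left (v v' w : TangentSpace I x) :
    ∀ᶠ y in 𝓝 x, nablaField I (extVec I (v + v')) (extVec I w) y
      = (nablaField I (extVec I v) (extVec I w) + nablaField I (extVec I v') (extVec I w)) y := by
  filter_upwards [extVec_add v v', eventually_mdifferentiableAt_extVec w] with y h hw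
  simp only [nablaField, h, Pi.add_apply, nabla_add_left _ _ hw]

lemma nablaField_extVec_smul_left (c : ℝ) (v w : TangentSpace I x) :
    ∀ᶠ y in 𝓝 x, nablaField I (extVec I (c • v)) (extVec I w) y
      = (c • nablaField I (extVec I v) (extVec I w)) y := by
  filter_upwards [extVec_smul c v, eventually_mdifferentiableAt_extVec w] with y h hw
  simp only [nablaField, h, Pi.smul_apply, nabla_smul_left _ _ hw]

lemma nabla_const_smul_right (v : TangentSpace I x) (c : ℝ) (hY : MDiffAt (T% Y) x) :
    nabla I v (c • Y) = c • nabla I v Y := by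
  have h := nabla_smul_right v (f := fun _ => c) mdifferentiableAt_const hY
  rw [show dirDeriv I (fun _ => c) v = 0 by simp [dirDeriv, mvfderiv_const], zero_smul,
    add_zero] at h
  exact h

lemma nablaField_extVec_add_right (v w w' : TangentSpace I x) :
    ∀ᶠ y in 𝓝 x, nablaField I (extVec I v) (extVec I (w + w')) y
      = (nablaField I (extVec I v) (extVec I w) + nablaField I (extVec I v) (extVec I w')) y := by
  filter_upwards [(extVec_add w w').eventually_nhds, eventually_mdifferentiableAt_extVec w,
    eventually_mdifferentiableAt_extVec w'] with y h hw hw'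
  simp only [nablaField, nabla_congr _ h, Pi.add_apply, nabla_add_right _ hw hw']

lemma nablaField_extVec_smul_right (c : ℝ) (v w : TangentSpace I x) :
    ∀ᶠ y in 𝓝 x, nablaField I (extVec I v) (extVec I (c • w)) y
      = (c • nablaField I (extVec I v) (extVec I w)) y := by
  filter_upwards [(extVec_smul c w).eventually_nhds, eventually_mdifferentiableAt_extVec w]
    with y h hw
  simp only [nablaField, nabla_congr _ h, Pi.smul_apply, nabla_const_smul_right _ c hw]

/-- The curvature `R(u, t)w` as a bilinear map in `u` and `w`. -/
noncomputable def curvatureₗ (t : TangentSpace I x) :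
    TangentSpace I x →ₗ[ℝ] TangentSpace I x →ₗ[ℝ] TangentSpace I x :=
  LinearMap.mk₂ ℝ (fun u w => curvature I u t w)
    (fun u u' w => by
      have h := mdifferentiableAt_nablaField_extVec (I := I) (x := x)
      simp only [curvature_eq, nabla_add_left _ _ (h _ _),
        nabla_congr t (nablaField_extVec_add_left u u' w), nabla_add_right t (h u w) (h u' w)]
      abel)
    (fun c u w => by
      have h := mdifferentiableAt_nablaField_extVec (I := I) (x := x)
      simp only [curvature_eq, nabla_smul_left _ _ (h _ _),
        nabla_congr t (nablaField_extVec_smul_left c u w), nabla_const_smul_right t c (h u w),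
        smul_sub])
    (fun u w w' => by
      have h := mdifferentiableAt_nablaField_extVec (I := I) (x := x)
      simp only [curvature_eq, nabla_congr _ (nablaField_extVec_add_right _ w w'),
        nabla_add_right _ (h _ w) (h _ w')]
      abel)
    (fun c u w => by
      have h := mdifferentiableAt_nablaField_extVec (I := I) (x := x)
      simp only [curvature_eq, nabla_congr _ (nablaField_extVec_smul_right c _ w),
        nabla_const_smul_right _ c (h _ w), smul_sub])

lemma curvatureₗ_apply (t u w : TangentSpace I x) : curvatureₗ t u w = curvature I u t w := rfl

lemma sum_curvature {ι : Type*} [Fintype ι] (b : OrthonormalBasis ι ℝ (TangentSpace I x))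
    (t : TangentSpace I x) : ∑ i, curvature I (b i) t (b i) = -ricci I t := by
  refine (sum_orthonormalBasis_eq (curvatureₗ t) b
    (stdOrthonormalBasis ℝ (TangentSpace I x))).trans ?_
  simp only [curvatureₗ_apply, ricci, ← Finset.sum_neg_distrib]
  exact Finset.sum_congr rfl fun k _ => curvature_swap _ _ _

lemma ricci_smul (c : ℝ) (t : TangentSpace I x) : ricci I (c • t) = c • ricci I t := by
  simp only [ricci, Finset.smul_sum]
  refine Finset.sum_congr rfl fun k _ => ?_
  rw [curvature_swap, curvature_swap t, curvature_swap, neg_neg, curvature_swap _ t, neg_neg]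
  simp only [← curvatureₗ_apply, map_smul, LinearMap.smul_apply]

end Curvature

section Bitension

open VectorField

variable
  {E : Type*} [NormedAddCommGroup E] [NormedSpace ℝ E] [FiniteDimensional ℝ E]
  {H : Type*} [TopologicalSpace H] {I : ModelWithCorners ℝ E H}
  {M : Type*} [TopologicalSpace M] [ChartedSpace H M] [IsManifold I ∞ M]
  {E' : Type*} [NormedAddCommGroup E'] [NormedSpace ℝ E'] [FiniteDimensional ℝ E']
  {H' : Type*} [TopologicalSpace H'] {J : ModelWithCorners ℝ E' H'}
  {N : Type*} [TopologicalSpace N] [ChartedSpace H' N] [IsManifold J ∞ N]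
  {φ : M → N} {x : M} {μ : Π y : M, TangentSpace I y}
  [RiemannianBundle (fun x : M => TangentSpace I x)]
  [RiemannianBundle (fun y : N => TangentSpace J y)]
  {ι κ : Type*} [Fintype ι] [Fintype κ] {U : Set M} {e : ι → Π y : M, TangentSpace I y}
  {f : κ → Π y : M, TangentSpace I y}
  [IsContMDiffRiemannianBundle I ∞ E (fun x : M => TangentSpace I x)]
  [IsContMDiffRiemannianBundle J ∞ E' (fun y : N => TangentSpace J y)]

/-! ### The bitension field of a Riemannian submersion -/

lemma IsAdaptedFrame.sum_curvature_mfderiv (hF : IsAdaptedFrame I J φ U e f)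
    (hφ : IsRiemannianSubmersion I J φ) (hx : x ∈ U) (t : TangentSpace J (φ x)) :
    ∑ k, curvature J (mfderiv I J φ x (stdOrthonormalBasis ℝ (TangentSpace I x) k)) t
      (mfderiv I J φ x (stdOrthonormalBasis ℝ (TangentSpace I x) k)) = -ricci J t := by
  refine (sum_orthonormalBasis_eq ((curvatureₗ t).compl₁₂ (mfderiv I J φ x).toLinearMap
    (mfderiv I J φ x).toLinearMap) (stdOrthonormalBasis ℝ (TangentSpace I x)) (hF.basis hx)).trans ?_
  rw [← sum_curvature (hF.basisMap hφ hx)]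
  simp only [Fintype.sum_sum_type, hF.basis_apply hx, hF.basisMap_apply hφ hx, Sum.elim_inl,
    Sum.elim_inr, LinearMap.compl₁₂_apply, ContinuousLinearMap.coe_coe,
    mem_vertical.1 (hF.vertical_f _ x hx), curvatureₗ_apply, add_eq_left]
  exact Finset.sum_eq_zero fun _ _ => map_zero (curvatureₗ t 0)

lemma IsAdaptedFrame.bitension_eq (hF : IsAdaptedFrame I J φ U e f)
    (hφ : IsRiemannianSubmersion I J φ) (hx : x ∈ U) (hμ : CMDiff[U] ∞ (T% μ))
    (hμ' : ∀ y ∈ U, μ y ∈ horizontal I J φ y) (c : ℝ)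
    (hc : ∀ y ∈ U, c • μ y = ∑ s, horPart I J φ (nablaField I (f s) (f s)) y) :
    bitension I J φ x =
      -c • mfderiv I J φ x
        (∑ i, (nabla I (e i x) (horPart I J φ (nablaField I (e i) μ))
            - nabla I (horPart I J φ (nablaField I (e i) (e i)) x) μ
            + mlieBracket I μ (verPart I J φ (nablaField I (e i) (e i))) x)
          + ∑ s, (mlieBracket I (mlieBracket I μ (f s)) (f s) x
            + mlieBracket I μ (verPart I J φ (nablaField I (f s) (f s))) x)
          - c • nabla I (μ x) μ)
      - c • ricci J (mfderiv I J φ x (μ x)) := by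
  have hμx {y} (hy : y ∈ U) := mdifferentiableAt_of_contMDiffOn hF.isOpen hμ hy
  have hτ : ∀ y ∈ U, tension I J φ y = -c • push I J φ μ y := fun y hy => by
    rw [tension_eq hφ hF hy, ← hc y hy, map_smul, neg_smul]
    rfl
  have hU : ∀ᶠ y in 𝓝 x, y ∈ U := hF.isOpen.mem_nhds hx
  have hσ := hF.hasMDiffPullNablaAt_push hφ hx hμ hμ'
  have h1 (v w : TangentSpace I x) : secondCovDeriv I J φ v w (tension I J φ)
      = -c • secondCovDeriv I J φ v w (push I J φ μ) := by
    rw [secondCovDeriv_congr v w (hU.mono hτ), secondCovDeriv_const_smul v w (-c)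
      (hU.mono fun y hy => mdiffAlongAt_push hφ.smooth (hμx hy)) hσ]
  have h2 := sum_orthonormalBasis_eq (secondCovDerivₗ hσ)
    (stdOrthonormalBasis ℝ (TangentSpace I x)) (hF.basis hx)
  have h3 (v w : TangentSpace I x) :
    secondCovDerivₗ hσ v w = secondCovDeriv I J φ v w (push I J φ μ) := rfl
  have h4 : ∑ s, nabla I (horPart I J φ (nablaField I (f s) (f s)) x) μ
      = c • nabla I (μ x) μ := by
    let L : TangentSpace I x →ₗ[ℝ] TangentSpace I x :=
      { toFun := fun v => nabla I v μ
        map_add' := fun v w => nabla_add_left v w (hμx hx)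
        map_smul' := fun a v => nabla_smul_left a v (hμx hx) }
    change ∑ s, L (horPart I J φ (nablaField I (f s) (f s)) x) = c • L (μ x)
    rw [← map_sum, ← hc x hx, map_smul]
  simp only [h3, Fintype.sum_sum_type, hF.basis_apply hx, Sum.elim_inl, Sum.elim_inr,
    hF.secondCovDeriv_push_e hφ hx hμ hμ', hF.secondCovDeriv_push_f hφ hx hμ hμ', ← map_sum,
    ← map_add] at h2
  simp only [bitension, pullLaplacian, neg_neg, h1, ← Finset.smul_sum]
  rw [hF.sum_curvature_mfderiv hφ hx, hτ x hx, ricci_smul, h2, sub_neg_eq_add, neg_smul _ (ricci J _),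
    ← sub_eq_add_neg, ← h4, Finset.sum_sub_distrib, add_sub_assoc]
  rfl

lemma IsAdaptedFrame.card_add_card (hF : IsAdaptedFrame I J φ U e f) (hx : x ∈ U) :
    Fintype.card ι + Fintype.card κ = Module.finrank ℝ E := by
  rw [← Fintype.card_sum, ← Module.finrank_eq_card_basis (hF.basis hx).toBasis]
  rfl

lemma IsAdaptedFrame.contMDiffOn_meanCurvature {r : ℕ} {f : Fin r → Π y : M, TangentSpace I y}
    (hF : IsAdaptedFrame I J φ U e f) : CMDiff[U] ∞ (T% (meanCurvature I J φ f)) :=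
  (contMDiffOn_const (c := 1 / (r : ℝ))).smul_section (ContMDiffOn.sum_section fun s _ =>
    hF.contMDiffOn_horPart (contMDiffOn_nablaField hF.isOpen (hF.smooth_f s) (hF.smooth_f s)))

lemma meanCurvature_mem_horizontal {r : ℕ} (f : Fin r → Π y : M, TangentSpace I y) (y : M) :
    meanCurvature I J φ f y ∈ horizontal I J φ y :=
  Submodule.smul_mem _ _ (Submodule.sum_mem _ fun _ _ => horPart_mem _ y)

lemma smul_meanCurvature {r : ℕ} (f : Fin r → Π y : M, TangentSpace I y) (y : M) :
    (r : ℝ) • meanCurvature I J φ f y = ∑ s, horPart I J φ (nablaField I (f s) (f s)) y := by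
  rcases Nat.eq_zero_or_pos r with rfl | hr
  · simp
  · rw [meanCurvature, smul_smul, mul_one_div_cancel (by positivity), one_smul]

end Bitension

end RiemSubm

open RiemSubm VectorField in
/-- The bitension field of a Riemannian submersion `φ : (M^m, g) → (N^n, h)` in an adapted
orthonormal frame. -/
theorem mainTheorem1 {m n : ℕ}
    {M : Type*} [TopologicalSpace M] [ChartedSpace (EuclideanSpace ℝ (Fin m)) M]
    [IsManifold (𝓡 m) ∞ M]
    [RiemannianBundle (fun x : M => TangentSpace (𝓡 m) x)]
    [IsContMDiffRiemannianBundle (𝓡 m) ∞ (EuclideanSpace ℝ (Fin m))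
      (fun x : M => TangentSpace (𝓡 m) x)]
    {N : Type*} [TopologicalSpace N] [ChartedSpace (EuclideanSpace ℝ (Fin n)) N]
    [IsManifold (𝓡 n) ∞ N]
    [RiemannianBundle (fun y : N => TangentSpace (𝓡 n) y)]
    [IsContMDiffRiemannianBundle (𝓡 n) ∞ (EuclideanSpace ℝ (Fin n))
      (fun y : N => TangentSpace (𝓡 n) y)]
    (φ : M → N) (hφ : IsRiemannianSubmersion (𝓡 m) (𝓡 n) φ)
    (U : Set M)
    (e : Fin n → Π y : M, TangentSpace (𝓡 m) y)
    (f : Fin (m - n) → Π y : M, TangentSpace (𝓡 m) y)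
    (hframe : IsAdaptedFrame (𝓡 m) (𝓡 n) φ U e f)
    (μ : Π y : M, TangentSpace (𝓡 m) y)
    (hμ : μ = meanCurvature (𝓡 m) (𝓡 n) φ f)
    (x : M) (hx : x ∈ U) :
    bitension (𝓡 m) (𝓡 n) φ x =
      -((m : ℝ) - (n : ℝ)) • mfderiv (𝓡 m) (𝓡 n) φ x
        (∑ i, (nabla (𝓡 m) (e i x) (horPart (𝓡 m) (𝓡 n) φ (nablaField (𝓡 m) (e i) μ))
            - nabla (𝓡 m) (horPart (𝓡 m) (𝓡 n) φ (nablaField (𝓡 m) (e i) (e i)) x) μ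
            + mlieBracket (𝓡 m) μ (verPart (𝓡 m) (𝓡 n) φ (nablaField (𝓡 m) (e i) (e i))) x)
          + ∑ s, (mlieBracket (𝓡 m) (mlieBracket (𝓡 m) μ (f s)) (f s) x
            + mlieBracket (𝓡 m) μ (verPart (𝓡 m) (𝓡 n) φ (nablaField (𝓡 m) (f s) (f s))) x)
          - ((m : ℝ) - (n : ℝ)) • nabla (𝓡 m) (μ x) μ)
      - ((m : ℝ) - (n : ℝ)) • ricci (𝓡 n) (mfderiv (𝓡 m) (𝓡 n) φ x (μ x)) := by
  subst hμ
  have hcard : n + (m - n) = m := by simpa using hframe.card_add_card hx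
  have hmn : ((m - n : ℕ) : ℝ) = (m : ℝ) - (n : ℝ) := by
    rw [Nat.cast_sub (by omega)]
  exact hframe.bitension_eq hφ hx hframe.contMDiffOn_meanCurvature
    (fun y _ => meanCurvature_mem_horizontal f y) _
    (fun y _ => by rw [← hmn, smul_meanCurvature])
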